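/- For $n\ge 1$ let $Q_n$ be the hypercube with vertex set $\{0,1\}^n$, two vectors being adjacent if they differ in exactly one coordinate. An embedding of a graph $G$ into a graph $H$ is an injective map $f:V(G)\to V(H)$ together with, for each edge $\{u,v\}$ of $G$, a path $P_f(u,v)$ in $H$ between $f(u)$ and $f(v)$; its wirelength is the sum of the lengths of the paths $P_f(u,v)$ over all edges $\{u,v\}$ of $G$, and $WL(G,H)$ is the minimum wirelength over all embeddings of $G$ into $H$. The Gray code map $\xi_m:\{0,1\}^m\to\{1,\dots,2^m\}$ is the position in the binary reflected Gray code: $\xi_0=1$ on the empty word, and for a word $w$ of length $m$, $\xi_{m+1}(0w)=\xi_m(w)$ and $\xi_{m+1}(1w)=2^{m+1}+1-\xi_m(w)$. For $n=n_1+\cdots+n_k$, the $k$-order Gray code map $\xi_{n_1\ldots n_k}$ sends the concatenation $v_1\ldots v_k\in\{0,1\}^n$ of words $v_i\in\{0,1\}^{n_i}$ to $(\xi_{n_1}(v_1),\dots,\xi_{n_k}(v_k))$. Theorem. Let $k\ge 1$, let $n_1,\dots,n_k\ge 2$ be integers with $\sum_{i=1}^k n_i=n$, and let $\mathscr{G}=\mathscr{G}_1\times\cdots\times\mathscr{G}_k$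 be the Cartesian product of graphs $\mathscr{G}_i\in\{P_{2^{n_i}},C_{2^{n_i}}\}$, where the path $P_m$ and the cycle $C_m$ have vertices $1,\dots,m$ in this order. Then $$WL(Q_n,\mathscr{G})=\sum_{i=1}^k \mathscr{L}_i,\qquad \mathscr{L}_i=\begin{cases}2^{n-n_i}\left(3\cdot 2^{2n_i-3}-2^{n_i-1}\right), & \mathscr{G}_i=C_{2^{n_i}},\\ 2^{n-n_i}\left(2^{2n_i-1}-2^{n_i-1}\right), & \mathscr{G}_i=P_{2^{n_i}}.\end{cases}$$ Moreover, the $k$-order Gray code embedding is optimal: the map $\xi_{n_1\ldots n_k}$, together with any choice of shortest paths in $\mathscr{G}$ between the images of adjacent vertices, is an embedding of $Q_n$ into $\mathscr{G}$ whose wirelength is $WL(Q_n,\mathscr{G})$. -/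

import Mathlib

/-- The hypercube `Q_n`: the vertices are the 0-1 vectors of length `n`, and two of them are
adjacent if they differ in exactly one coordinate. -/
def hypercube (n : ℕ) : SimpleGraph (Fin n → Bool) where
  Adj u v := (Finset.univ.filter fun i => u i ≠ v i).card = 1
  symm := ⟨fun u v h => by simpa only [ne_comm] using h⟩
  loopless := ⟨fun u h => by simp at h⟩

instance hypercube.instDecidableRelAdj (n : ℕ) : DecidableRel (hypercube n).Adj :=
  fun u v => inferInstanceAs
    (Decidable ((Finset.univ.filter fun i => u i ≠ v i).card = 1))

/-- The two kinds of factors: a path or a cycle. -/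
inductive FactorKind where
  | path
  | cycle

/-- The factor with `m` vertices of the given kind: the path `P_m` or the cycle `C_m`. -/
def FactorKind.graph : FactorKind → (m : ℕ) → SimpleGraph (Fin m)
  | .path, m => SimpleGraph.pathGraph m
  | .cycle, m => SimpleGraph.cycleGraph m

/-- The Cartesian product of a family of graphs: two tuples are adjacent if they are adjacent in
one coordinate and agree in all the others. -/
def cartesianProduct {ι : Type*} {V : ι → Type*} (G : (i : ι) → SimpleGraph (V i)) :
    SimpleGraph ((i : ι) → V i) where
  Adj x y := ∃ i, (G i).Adj (x i) (y i) ∧ ∀ j, j ≠ i → x j = y j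
  symm := ⟨fun _ _ ⟨i, h, h'⟩ => ⟨i, h.symm, fun j hj => (h' j hj).symm⟩⟩
  loopless := ⟨fun _ ⟨_, h, _⟩ => h.ne rfl⟩

/-- The product `G_1 × ⋯ × G_k`, where `G_i` is the path or cycle (according to `c i`) with
`2 ^ d i` vertices. -/
def factorProduct {k : ℕ} (d : Fin k → ℕ) (c : Fin k → FactorKind) :
    SimpleGraph ((i : Fin k) → Fin (2 ^ d i)) :=
  cartesianProduct fun i => (c i).graph (2 ^ d i)

/-- An embedding of a guest graph `G` into a host graph `H`: an injective map `f` on the vertices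
together with, for each edge `{u, v}` of `G`, a path in `H` between `f u` and `f v`.
(Each path is recorded with one of its two directions, from `src` to `tgt`.) -/
structure GraphEmbedding {V W : Type*} (G : SimpleGraph V) (H : SimpleGraph W) where
  toFun : V → W
  injective : Function.Injective toFun
  src : G.edgeSet → W
  tgt : G.edgeSet → W
  route : (e : G.edgeSet) → H.Path (src e) (tgt e)
  route_ends : ∀ e : G.edgeSet, s(src e, tgt e) = Sym2.map toFun (e : Sym2 V)

namespace GraphEmbedding

/-- The wirelength of an embedding: the sum, over the edges of the guest graph, of the lengths of
the paths in the host graph assigned to them. -/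
def wirelength {V W : Type*} {G : SimpleGraph V} {H : SimpleGraph W} [Fintype G.edgeSet]
    (φ : GraphEmbedding G H) : ℕ :=
  ∑ e : G.edgeSet, (φ.route e).1.length

/-- All the paths of the embedding are shortest paths of the host graph. -/
def UsesShortestPaths {V W : Type*} {G : SimpleGraph V} {H : SimpleGraph W}
    (φ : GraphEmbedding G H) : Prop :=
  ∀ e : G.edgeSet, (φ.route e).1.length = H.dist (φ.src e) (φ.tgt e)

end GraphEmbedding

/-- The (binary reflected) Gray code map `ξ_n`, with positions counted from `0`: a word `0w` has the
position of `w`, and a word `1w` has the position of `0w` counted from the end. -/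
def grayCode : (n : ℕ) → (Fin n → Bool) → Fin (2 ^ n)
  | 0, _ => 0
  | n + 1, v =>
    let p : Fin (2 ^ (n + 1)) :=
      Fin.castLE (Nat.pow_le_pow_right Nat.two_pos n.le_succ) (grayCode n fun i => v i.succ)
    if v 0 then p.rev else p

/-- The `k`-order Gray code map: a 0-1 vector of length `n = d_1 + ⋯ + d_k` is cut into consecutive
blocks of lengths `d_1, …, d_k`, and the Gray code map is applied to each block. -/
def grayCodeTuple {k n : ℕ} (d : Fin k → ℕ) (hn : ∑ i, d i = n) (v : Fin n → Bool) :
    (i : Fin k) → Fin (2 ^ d i) :=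
  fun i => grayCode (d i) fun j => v (Fin.cast hn (finSigmaFinEquiv ⟨i, j⟩))

/-- The contribution to the minimum wirelength of a factor with `2 ^ m` vertices, for `m ≥ 2`
(the differences are then nonnegative, also in the exponents, as long as `m ≤ n`). -/
def FactorKind.contribution (n m : ℕ) : FactorKind → ℕ
  | .cycle => 2 ^ (n - m) * (3 * 2 ^ (2 * m - 3) - 2 ^ (m - 1))
  | .path => 2 ^ (n - m) * (2 ^ (2 * m - 1) - 2 ^ (m - 1))

/-!
The wirelength is bounded from below factor by factor. The length of a path in the product is at
least the sum, over the factors, of the distances of the coordinates of its ends, so the wirelength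
of an embedding is at least the sum of the wirelengths of its coordinate maps
`Q_n → {0, …, 2 ^ m - 1}`. The fibres of such a map have the same size `N = 2 ^ (n - m)`. Expanding
every fibre to a block of `N` positions, numbered so that the edges inside it are short on average
(`exists_numbering`), and averaging over the two orientations of the blocks reduces the bound to
bijective numberings (`FactorKind.le_sum_posDist_of_card_fiber`).

For a path, the wirelength of a numbering is the sum of the edge boundaries of its initial segments,
and Harper's edge-isoperimetric theorem (`two_mul_minBoundary_le`) gives the bound.

For a cycle with `4 q = 2 ^ n` vertices, twice the distance of two positions is the number of
half-arcs that separate them, so that the edge boundaries of the `4 q` half-arcs have to be summed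
up. Each boundary is at least `2 q`, and the average has to exceed this by `q - 1`. Let `g i t` be
the number of vertices of the half-arc starting at `t` that have the `i`-th bit `1`, minus `q`.
* Splitting the cube in the direction `i` and applying Harper's theorem to both halves shows that
  the excess at `t` is at least `2 * minBoundary (n - 2) |g i t|` (`IsHalf.le_dirBoundary`).
* The excess is at least `q` unless `|g i t| > q / 2` for some `i` (`IsHalf.six_mul_le_dirBoundary`).
  If some `|g i t|` is between `q / 4` and `q / 2`, this follows from the preceding bound, and if all
  of them are smaller, from a Poincaré inequality of second order (`poincare_second_order`).
* By `IsHalf.abs_bias_add_abs_bias_le`, the half-arc is thus near to at most one half cube, given by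
  a direction and a sign, and the times near to different half cubes are separated by gaps. The set
  of the times near to a given half cube has at most `q - 1` elements, since overlapping half-arcs
  have a limited intersection, and `g i` passes each level below its maximum twice. Two properties
  of averages of `minBoundary` then show that the sum of the excess over these times and the gap that
  follows them is at least what is needed (`IsBiasFunction.le_sum_near`, `le_sum_of_isBiasFunction`).

For the Gray code, adjacent vertices have images that differ in one coordinate only. The edges of
the leading direction of a block join every position to its reflection, and the two halves are Gray
codes of one dimension less, which gives a recursion for the wirelength (`grayLength_succ_le`) and
shows that the lower bound is attained.
-/

/-! ### The minimum edge boundary of a set of given size -/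

/-- The size of the edge boundary in `Q_k` of the first `x` binary words of length `k`, by the
recursion on the leading bit. By `two_mul_minBoundary_le`, this is the minimum size of the edge
boundary of a set of `x` vertices. Only the values at `0 ≤ x ≤ 2 ^ k` have a meaning; the
argument and the value are integers so that no subtraction is truncated. -/
def minBoundary : ℕ → ℤ → ℤ
  | 0, _ => 0
  | k + 1, x =>
    if x ≤ 2 ^ k then minBoundary k x + x else minBoundary k (x - 2 ^ k) + 2 ^ (k + 1) - x

namespace minBoundary

theorem of_le {k : ℕ} {x : ℤ} (hx : x ≤ 2 ^ k) :
    minBoundary (k + 1) x = minBoundary k x + x := by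
  rw [minBoundary, if_pos hx]

@[simp] theorem at_zero (k : ℕ) : minBoundary k 0 = 0 := by
  induction k with
  | zero => rfl
  | succ k ih => rw [of_le (by positivity), ih, add_zero]

@[simp] theorem at_two_pow (k : ℕ) : minBoundary k (2 ^ k) = 0 := by
  induction k with
  | zero => rfl
  | succ k ih =>
    have h : (0 : ℤ) < 2 ^ k := by positivity
    rw [minBoundary, if_neg (by rw [pow_succ]; omega)]
    rw [show (2 : ℤ) ^ (k + 1) - 2 ^ k = 2 ^ k by ring, ih]
    ring

theorem of_ge {k : ℕ} {x : ℤ} (hx : 2 ^ k ≤ x) :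
    minBoundary (k + 1) x = minBoundary k (x - 2 ^ k) + 2 ^ (k + 1) - x := by
  rcases hx.lt_or_eq with h | rfl
  · rw [minBoundary, if_neg (not_le.2 h)]
  · rw [of_le le_rfl, at_two_pow, sub_self, at_zero]
    ring

theorem symm {k : ℕ} : ∀ {x : ℤ}, 0 ≤ x → x ≤ 2 ^ k →
    minBoundary k (2 ^ k - x) = minBoundary k x := by
  induction k with
  | zero => intro x _ _; rfl
  | succ k ih =>
    intro x h0 h1
    have h : (2 : ℤ) ^ (k + 1) = 2 ^ k + 2 ^ k := by ring
    rcases le_total x (2 ^ k) with hx | hx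
    · rw [of_le hx, of_ge (by omega), show (2 : ℤ) ^ (k + 1) - x - 2 ^ k = 2 ^ k - x by omega,
        ih h0 hx]
      ring
    · have := ih (x := x - 2 ^ k) (by omega) (by omega)
      rw [of_ge hx, of_le (by omega), ← this,
        show (2 : ℤ) ^ (k + 1) - x = 2 ^ k - (x - 2 ^ k) by omega, this]
      omega

theorem nonneg {k : ℕ} : ∀ {x : ℤ}, 0 ≤ x → x ≤ 2 ^ k → 0 ≤ minBoundary k x := by
  induction k with
  | zero => intro x _ _; exact le_rfl
  | succ k ih =>
    intro x h0 h1
    have h : (2 : ℤ) ^ (k + 1) = 2 ^ k + 2 ^ k := by ring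
    rcases le_total x (2 ^ k) with hx | hx
    · rw [of_le hx]
      have := ih h0 hx
      omega
    · rw [of_ge hx]
      have := ih (x := x - 2 ^ k) (by omega) (by omega)
      omega

/-- The inequality behind the induction step of the edge-isoperimetric theorem: a set that meets
the two halves of `Q_{k+1}` in `a` and `b` points has at least `|a - b|` boundary edges between
the halves. -/
theorem succ_add_le {k : ℕ} : ∀ {a b : ℤ}, 0 ≤ a → a ≤ 2 ^ k → 0 ≤ b → b ≤ 2 ^ k →
    minBoundary (k + 1) (a + b) ≤ minBoundary k a + minBoundary k b + |a - b| := by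
  induction k with
  | zero =>
    intro a b ha ha' hb hb'
    norm_num at ha' hb'
    obtain rfl | rfl : a = 0 ∨ a = 1 := by omega
    all_goals
      obtain rfl | rfl : b = 0 ∨ b = 1 := by omega
      all_goals simp [minBoundary]
  | succ k ih =>
    have h2 : (2 : ℤ) ^ (k + 1) = 2 ^ k + 2 ^ k := by ring
    have h4 : (2 : ℤ) ^ (k + 1 + 1) = 2 ^ k + 2 ^ k + (2 ^ k + 2 ^ k) := by ring
    -- the case where `a` and `b` are on different sides of `2 ^ k`
    have mixed : ∀ {a b : ℤ}, 2 ^ k ≤ a → a ≤ 2 ^ (k + 1) → 0 ≤ b → b ≤ 2 ^ k →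
        minBoundary (k + 1 + 1) (a + b) ≤
          minBoundary (k + 1) a + minBoundary (k + 1) b + |a - b| := by
      intro a b ha ha' hb hb'
      have key := ih (a := a - 2 ^ k) (b := b) (by omega) (by omega) hb hb'
      have e : |a - b| = a - b := abs_of_nonneg (by omega)
      rw [of_ge ha, of_le hb', e]
      rcases abs_cases (a - 2 ^ k - b) with ⟨e', _⟩ | ⟨e', _⟩ <;> rw [e'] at key <;>
      rcases le_total (a - 2 ^ k + b) (2 ^ k) with hc | hc
      · rw [of_le hc] at key
        rw [of_le (by omega), of_ge (by omega), show a + b - 2 ^ k = a - 2 ^ k + b by omega]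
        omega
      · rw [of_ge hc] at key
        rw [of_ge (by omega), of_le (by omega),
          show a + b - 2 ^ (k + 1) = a - 2 ^ k + b - 2 ^ k by omega]
        omega
      · rw [of_le hc] at key
        rw [of_le (by omega), of_ge (by omega), show a + b - 2 ^ k = a - 2 ^ k + b by omega]
        omega
      · rw [of_ge hc] at key
        rw [of_ge (by omega), of_le (by omega),
          show a + b - 2 ^ (k + 1) = a - 2 ^ k + b - 2 ^ k by omega]
        omega
    intro a b ha ha' hb hb'
    rcases le_total a (2 ^ k) with h | h <;> rcases le_total b (2 ^ k) with h' | h'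
    · have key := ih ha h hb h'
      rw [of_le h, of_le h', of_le (by omega)]
      omega
    · rw [add_comm a b, abs_sub_comm, add_comm (minBoundary (k + 1) a)]
      exact mixed h' hb' ha h
    · exact mixed h ha' hb h'
    · have key := ih (a := a - 2 ^ k) (b := b - 2 ^ k) (by omega) (by omega) (by omega) (by omega)
      rw [of_ge h, of_ge h', of_ge (by omega),
        show a + b - 2 ^ (k + 1) = a - 2 ^ k + (b - 2 ^ k) by omega]
      rw [show a - 2 ^ k - (b - 2 ^ k) = a - b by ring] at key
      omega

/-- In the middle half of its domain, `minBoundary k` is at least its value `2 ^ (k - 1)` at the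
middle. -/
theorem two_pow_le_two_mul {k : ℕ} {x : ℤ} (h : 2 ^ k ≤ 4 * x) (h' : 4 * x ≤ 3 * 2 ^ k) :
    2 ^ k ≤ 2 * minBoundary k x := by
  have lower : ∀ {x : ℤ}, 2 ^ k ≤ 4 * x → 2 * x ≤ 2 ^ k → 2 ^ k ≤ 2 * minBoundary k x := by
    intro x h h'
    obtain _ | _ | k := k
    · norm_num at h h'; omega
    · norm_num at h h'
      obtain rfl : x = 1 := by omega
      simp [minBoundary]
    · have h2 : (2 : ℤ) ^ (k + 1) = 2 ^ k + 2 ^ k := by ring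
      have h4 : (2 : ℤ) ^ (k + 1 + 1) = 2 ^ k + 2 ^ k + (2 ^ k + 2 ^ k) := by ring
      have := nonneg (k := k) (x := x - 2 ^ k) (by omega) (by omega)
      rw [of_le (by omega), of_ge (by omega)]
      omega
  rcases le_total (2 * x) (2 ^ k) with hx | hx
  · exact lower h hx
  · rw [← symm (by omega) (by omega)]
    exact lower (by omega) (by omega)

theorem sum_range_two_pow (k : ℕ) :
    2 * ∑ x ∈ Finset.range (2 ^ k), minBoundary k x = 4 ^ k - 2 ^ k := by
  induction k with
  | zero => simp
  | succ k ih =>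
    have e1 : ∑ x ∈ Finset.range (2 ^ k), minBoundary (k + 1) (x : ℤ) =
        ∑ x ∈ Finset.range (2 ^ k), (minBoundary k x + x) := by
      refine Finset.sum_congr rfl fun x hx => of_le ?_
      exact_mod_cast (Finset.mem_range.1 hx).le
    have e2 : ∑ x ∈ Finset.range (2 ^ k), minBoundary (k + 1) ((2 ^ k + x : ℕ) : ℤ) =
        ∑ x ∈ Finset.range (2 ^ k), (minBoundary k x + (2 ^ k - x)) := by
      refine Finset.sum_congr rfl fun x hx => ?_
      rw [of_ge (by push_cast; omega)]
      push_cast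
      rw [add_sub_cancel_left]
      ring
    rw [show 2 ^ (k + 1) = 2 ^ k + 2 ^ k by ring, Finset.sum_range_add, e1, e2,
      ← Finset.sum_add_distrib]
    have e3 : ∀ x : ℕ, minBoundary k x + x + (minBoundary k x + (2 ^ k - x)) =
        2 * minBoundary k x + 2 ^ k := fun x => by ring
    simp only [e3, Finset.sum_add_distrib, ← Finset.mul_sum, ih, Finset.sum_const,
      Finset.card_range, nsmul_eq_mul]
    push_cast
    have : (4 : ℤ) ^ k = 2 ^ k * 2 ^ k := by rw [← mul_pow]; norm_num
    rw [pow_succ, pow_succ, this]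
    ring

theorem sum_range_half (k : ℕ) :
    4 * ∑ x ∈ Finset.range (2 ^ k), minBoundary (k + 1) x = 4 ^ (k + 1) - 2 * 2 ^ (k + 1) := by
  have e1 : ∑ x ∈ Finset.range (2 ^ k), minBoundary (k + 1) (x : ℤ) =
      ∑ x ∈ Finset.range (2 ^ k), (minBoundary k x + x) := by
    refine Finset.sum_congr rfl fun x hx => of_le ?_
    exact_mod_cast (Finset.mem_range.1 hx).le
  have e2 : 2 * ∑ x ∈ Finset.range (2 ^ k), (x : ℤ) = 2 ^ k * (2 ^ k - 1) := by
    have := Finset.sum_range_id_mul_two (2 ^ k)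
    have h1 : 1 ≤ 2 ^ k := Nat.one_le_two_pow
    zify [h1] at this
    linarith
  have := sum_range_two_pow k
  have h4 : (4 : ℤ) ^ k = 2 ^ k * 2 ^ k := by rw [← mul_pow]; norm_num
  rw [e1, Finset.sum_add_distrib, pow_succ, pow_succ]
  linarith

/-- The values on an initial segment of the first half have an average of at most `2 ^ k - 1 / 2`,
just below the middle value `2 ^ k`, when the value at `0` is counted once and the others twice. -/
theorem sum_range_succ_le (k : ℕ) : ∀ X : ℕ, X < 2 ^ k →
    4 * ∑ y ∈ Finset.range (X + 1), minBoundary (k + 1) y ≤ (2 * X + 1) * (2 ^ (k + 1) - 1) := by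
  induction k with
  | zero =>
    intro X hX
    obtain rfl : X = 0 := by omega
    simp
  | succ k ih =>
    intro X hX
    have h2 : (2 : ℤ) ^ (k + 1 + 1) = 2 * 2 ^ (k + 1) := by ring
    have h2' : (2 : ℤ) ^ (k + 1) = 2 * 2 ^ k := by ring
    rcases lt_or_ge X (2 ^ k) with h | h
    · have e1 : ∑ y ∈ Finset.range (X + 1), minBoundary (k + 1 + 1) (y : ℤ) =
          ∑ y ∈ Finset.range (X + 1), (minBoundary (k + 1) y + y) := by
        refine Finset.sum_congr rfl fun y hy => of_le ?_
        have := Finset.mem_range.1 hy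
        exact_mod_cast (by omega : y ≤ 2 ^ (k + 1))
      have e2 : 2 * ∑ y ∈ Finset.range (X + 1), (y : ℤ) = (X + 1) * X := by
        have := Finset.sum_range_id_mul_two (X + 1)
        rw [Nat.add_sub_cancel] at this
        zify at this
        linarith
      have hX' : (X : ℤ) + 1 ≤ 2 ^ (k + 1) := by exact_mod_cast hX
      have := ih X h
      rw [e1, Finset.sum_add_distrib]
      nlinarith
    · -- subtract the terms beyond `X`, which are large, from the sum over the first half
      have tail : (2 ^ (k + 1) - (X + 1) : ℤ) * 2 ^ (k + 1) ≤
          ∑ y ∈ Finset.Ico (X + 1) (2 ^ (k + 1)), minBoundary (k + 1 + 1) y := by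
        have : ∀ y ∈ Finset.Ico (X + 1) (2 ^ (k + 1)),
            (2 ^ (k + 1) : ℤ) ≤ minBoundary (k + 1 + 1) y := by
          intro y hy
          have hy := Finset.mem_Ico.1 hy
          have h1 : (y : ℤ) ≤ 2 ^ (k + 1) := by exact_mod_cast hy.2.le
          have h3 : (2 : ℤ) ^ k ≤ y := by exact_mod_cast (by omega : 2 ^ k ≤ y)
          have := two_pow_le_two_mul (k := k + 1 + 1) (x := y) (by omega) (by omega)
          omega
        have := Finset.card_nsmul_le_sum _ _ _ this
        rw [Nat.card_Ico, nsmul_eq_mul, Nat.cast_sub (by omega)] at this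
        push_cast at this
        exact this
      have total := sum_range_half (k + 1)
      rw [← Finset.sum_range_add_sum_Ico _ (show X + 1 ≤ 2 ^ (k + 1) by omega)] at total
      have h4 : (4 : ℤ) ^ (k + 1 + 1) = 4 * (2 ^ (k + 1) * 2 ^ (k + 1)) := by
        rw [← mul_pow, pow_succ]; norm_num; ring
      have hX' : (X : ℤ) + 1 ≤ 2 ^ (k + 1) := by exact_mod_cast hX
      rw [h2, h4] at total
      rw [h2]
      nlinarith

/-- In the first half, no value from `X` on is below the average of the values up to `X`, weighted
as in `sum_range_succ_le`. -/
theorem sum_range_succ_le_mul (k : ℕ) : ∀ (X x : ℕ), X ≤ x → x < 2 ^ k →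
    2 * ∑ y ∈ Finset.range (X + 1), minBoundary (k + 1) y ≤
      (2 * X + 1) * minBoundary (k + 1) x := by
  induction k with
  | zero =>
    intro X x hX hx
    obtain rfl : x = 0 := by omega
    obtain rfl : X = 0 := by omega
    simp
  | succ k ih =>
    intro X x hX hx
    have h2 : (2 : ℤ) ^ (k + 1 + 1) = 2 * 2 ^ (k + 1) := by ring
    have h2' : (2 : ℤ) ^ (k + 1) = 2 * 2 ^ k := by ring
    have hx' : (x : ℤ) ≤ 2 ^ (k + 1) := by exact_mod_cast hx.le
    rcases lt_or_ge x (2 ^ k) with h | h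
    · have e1 : ∑ y ∈ Finset.range (X + 1), minBoundary (k + 1 + 1) (y : ℤ) =
          ∑ y ∈ Finset.range (X + 1), (minBoundary (k + 1) y + y) := by
        refine Finset.sum_congr rfl fun y hy => of_le ?_
        have := Finset.mem_range.1 hy
        exact_mod_cast (by omega : y ≤ 2 ^ (k + 1))
      have e2 : 2 * ∑ y ∈ Finset.range (X + 1), (y : ℤ) = (X + 1) * X := by
        have := Finset.sum_range_id_mul_two (X + 1)
        rw [Nat.add_sub_cancel] at this
        zify at this
        linarith
      have := ih X x hX h
      rw [e1, Finset.sum_add_distrib, of_le hx']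
      have : (X : ℤ) ≤ x := by exact_mod_cast hX
      nlinarith
    · have h1 := sum_range_succ_le (k + 1) X (by omega)
      have h3 : (2 : ℤ) ^ k ≤ x := by exact_mod_cast h
      have h5 := two_pow_le_two_mul (k := k + 1 + 1) (x := x) (by omega) (by omega)
      nlinarith

end minBoundary

/-! ### Sums over the hypercube and its directed edges -/

/-- The neighbour of `v` in the direction `j`. -/
def flipBit {n : ℕ} (v : Fin n → Bool) (j : Fin n) : Fin n → Bool :=
  Function.update v j (!v j)

/-- The vector that has the bit `b` at the place `i` and the bits of `w` at the other places. -/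
def insertBit {n : ℕ} (i : Fin (n + 1)) (b : Bool) (w : Fin n → Bool) : Fin (n + 1) → Bool :=
  i.insertNth b w

section Split

variable {n : ℕ}

@[simp] theorem flipBit_apply_same (v : Fin n → Bool) (j : Fin n) : flipBit v j j = !v j := by
  simp [flipBit]

theorem flipBit_apply_of_ne (v : Fin n → Bool) {i j : Fin n} (h : i ≠ j) :
    flipBit v j i = v i := by
  simp [flipBit, h]

@[simp] theorem flipBit_flipBit (v : Fin n → Bool) (j : Fin n) :
    flipBit (flipBit v j) j = v := by
  simp [flipBit]

@[simp] theorem insertBit_apply_same (i : Fin (n + 1)) (b : Bool) (w : Fin n → Bool) :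
    insertBit i b w i = b := by
  simp [insertBit]

@[simp] theorem insertBit_apply_succAbove (i : Fin (n + 1)) (b : Bool) (w : Fin n → Bool)
    (j : Fin n) : insertBit i b w (i.succAbove j) = w j := by
  simp [insertBit]

@[simp] theorem flipBit_insertBit_same (i : Fin (n + 1)) (b : Bool) (w : Fin n → Bool) :
    flipBit (insertBit i b w) i = insertBit i (!b) w := by
  simp [flipBit, insertBit]

@[simp] theorem flipBit_insertBit_succAbove (i : Fin (n + 1)) (b : Bool) (w : Fin n → Bool)
    (j : Fin n) :
    flipBit (insertBit i b w) (i.succAbove j) = insertBit i b (flipBit w j) := by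
  simp [flipBit, insertBit]

/-- Flipping a given bit is a permutation of the cube. -/
def flipBitEquiv (j : Fin n) : (Fin n → Bool) ≃ (Fin n → Bool) where
  toFun v := flipBit v j
  invFun v := flipBit v j
  left_inv v := flipBit_flipBit v j
  right_inv v := flipBit_flipBit v j

variable {M : Type*} [AddCommMonoid M]

theorem sum_flipBit (f : (Fin n → Bool) → M) (j : Fin n) :
    ∑ v, f (flipBit v j) = ∑ v, f v :=
  Equiv.sum_comp (flipBitEquiv j) f

theorem sum_eq_sum_insertBit (i : Fin (n + 1)) (f : (Fin (n + 1) → Bool) → M) :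
    ∑ v, f v = ∑ w, f (insertBit i false w) + ∑ w, f (insertBit i true w) := by
  rw [← Equiv.sum_comp (Fin.insertNthEquiv (fun _ => Bool) i) f, Fintype.sum_prod_type,
    Fintype.sum_bool, add_comm]
  rfl

/-- The sum over the directed edges of `Q_{n+1}`, split into the edges of direction `i` and the
edges of the two halves. -/
theorem sum_flipBit_eq_insertBit (i : Fin (n + 1))
    (k : (Fin (n + 1) → Bool) → (Fin (n + 1) → Bool) → M) :
    ∑ j, ∑ v, k v (flipBit v j) =
      (∑ w, k (insertBit i false w) (insertBit i true w) +
        ∑ w, k (insertBit i true w) (insertBit i false w)) +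
      (∑ j, ∑ w, k (insertBit i false w) (insertBit i false (flipBit w j)) +
        ∑ j, ∑ w, k (insertBit i true w) (insertBit i true (flipBit w j))) := by
  rw [Fin.sum_univ_succAbove _ i, sum_eq_sum_insertBit i]
  simp only [sum_eq_sum_insertBit i (fun v => k v (flipBit v (i.succAbove _))),
    flipBit_insertBit_same, flipBit_insertBit_succAbove, Finset.sum_add_distrib, Bool.not_false,
    Bool.not_true]

end Split

/-! ### The edge-isoperimetric inequality -/

section Isoperimetry

variable {n : ℕ}

/-- The number of directed edges of `Q_n` between a set and its complement, in terms of the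
indicator function of the set: twice the size of the edge boundary. -/
def dirBoundary (F : (Fin n → Bool) → ℤ) : ℤ :=
  ∑ j, ∑ v, |F v - F (flipBit v j)|

theorem dirBoundary_split (i : Fin (n + 1)) (F : (Fin (n + 1) → Bool) → ℤ) :
    dirBoundary F = 2 * ∑ w, |F (insertBit i false w) - F (insertBit i true w)| +
      (dirBoundary (fun w => F (insertBit i false w)) +
        dirBoundary (fun w => F (insertBit i true w))) := by
  rw [dirBoundary, sum_flipBit_eq_insertBit i fun u v => |F u - F v|]
  simp only [abs_sub_comm (F (insertBit i true _)) (F (insertBit i false _))]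
  rw [two_mul]
  rfl

theorem dirBoundary_split_le (i : Fin (n + 1)) (F : (Fin (n + 1) → Bool) → ℤ) :
    2 * |∑ w, F (insertBit i false w) - ∑ w, F (insertBit i true w)| +
      (dirBoundary (fun w => F (insertBit i false w)) +
        dirBoundary (fun w => F (insertBit i true w))) ≤ dirBoundary F := by
  rw [dirBoundary_split i, ← Finset.sum_sub_distrib]
  gcongr
  exact Finset.abs_sum_le_sum_abs _ _

theorem sum_indicator_nonneg {F : (Fin n → Bool) → ℤ} (hF : ∀ v, F v = 0 ∨ F v = 1) :
    0 ≤ ∑ v, F v :=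
  Finset.sum_nonneg fun v _ => by rcases hF v with h | h <;> simp [h]

theorem sum_indicator_le {F : (Fin n → Bool) → ℤ} (hF : ∀ v, F v = 0 ∨ F v = 1) :
    ∑ v, F v ≤ 2 ^ n := by
  calc ∑ v, F v ≤ ∑ _v : Fin n → Bool, 1 :=
        Finset.sum_le_sum fun v _ => by rcases hF v with h | h <;> simp [h]
    _ = 2 ^ n := by simp

/-- Harper's theorem: among the sets of vertices of `Q_n` of a given size, initial segments have
the smallest edge boundary. -/
theorem two_mul_minBoundary_le {n : ℕ} : ∀ {F : (Fin n → Bool) → ℤ},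
    (∀ v, F v = 0 ∨ F v = 1) → 2 * minBoundary n (∑ v, F v) ≤ dirBoundary F := by
  induction n with
  | zero => intro F _; simp [minBoundary, dirBoundary]
  | succ n ih =>
    intro F hF
    have h := dirBoundary_split_le 0 F
    have h0 := ih (F := fun w => F (insertBit 0 false w)) fun w => hF _
    have h1 := ih (F := fun w => F (insertBit 0 true w)) fun w => hF _
    have key := minBoundary.succ_add_le (k := n)
      (sum_indicator_nonneg (F := fun w => F (insertBit 0 false w)) fun w => hF _)
      (sum_indicator_le fun w => hF _)
      (sum_indicator_nonneg (F := fun w => F (insertBit 0 true w)) fun w => hF _)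
      (sum_indicator_le fun w => hF _)
    rw [sum_eq_sum_insertBit 0]
    linarith

/-! ### Poincaré inequalities -/

/-- The Poincaré inequality on the cube. -/
theorem poincare {n : ℕ} : ∀ G : (Fin n → Bool) → ℝ,
    4 * (∑ v, G v ^ 2 - (∑ v, G v) ^ 2 / 2 ^ n) ≤ ∑ j, ∑ v, (G v - G (flipBit v j)) ^ 2 := by
  induction n with
  | zero => intro G; simp
  | succ n ih =>
    intro G
    rw [sum_flipBit_eq_insertBit 0 fun u v => (G u - G v) ^ 2, sum_eq_sum_insertBit 0 fun v => G v,
      sum_eq_sum_insertBit 0 fun v => G v ^ 2]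
    have h0 := ih fun w => G (insertBit 0 false w)
    have h1 := ih fun w => G (insertBit 0 true w)
    set A := fun w => G (insertBit 0 false w)
    set B := fun w => G (insertBit 0 true w)
    have hN : (0 : ℝ) < 2 ^ n := by positivity
    have e1 : ∑ w, (A w - B w) ^ 2 = ∑ w, (B w - A w) ^ 2 :=
      Finset.sum_congr rfl fun w _ => by ring
    have cs : (∑ w, A w - ∑ w, B w) ^ 2 / 2 ^ n ≤ ∑ w, (A w - B w) ^ 2 := by
      rw [← Finset.sum_sub_distrib, div_le_iff₀ hN, mul_comm]
      have := sq_sum_le_card_mul_sum_sq (s := (Finset.univ : Finset (Fin n → Bool)))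
        (f := fun w => A w - B w)
      simpa using this
    have e2 : (∑ w, A w + ∑ w, B w) ^ 2 / 2 ^ (n + 1) = (∑ w, A w) ^ 2 / 2 ^ n +
        (∑ w, B w) ^ 2 / 2 ^ n - (∑ w, A w - ∑ w, B w) ^ 2 / 2 ^ n / 2 := by
      rw [pow_succ]; field_simp; ring
    change _ ≤ ∑ w, (A w - B w) ^ 2 + ∑ w, (B w - A w) ^ 2 + _
    change 4 * (∑ w, A w ^ 2 + ∑ w, B w ^ 2 - (∑ w, A w + ∑ w, B w) ^ 2 / 2 ^ (n + 1)) ≤ _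
    rw [e2, ← e1]
    linarith

/-- The Walsh function of the `i`-th coordinate: `1` where the `i`-th bit is set, `-1` elsewhere. -/
def bitSign (v : Fin n → Bool) (i : Fin n) : ℤ := if v i then 1 else -1

/-- The Poincaré inequality of second order: the Walsh coefficients of degree at least `2` count
twice in the energy, so that only those of degree `1` have to be taken off. -/
theorem poincare_second_order {n : ℕ} : ∀ G : (Fin n → Bool) → ℝ,
    8 * (∑ v, G v ^ 2 - (∑ v, G v) ^ 2 / 2 ^ n) -
      4 * ∑ i, (∑ v, bitSign v i * G v) ^ 2 / 2 ^ n ≤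
        ∑ j, ∑ v, (G v - G (flipBit v j)) ^ 2 := by
  induction n with
  | zero => intro G; simp
  | succ n ih =>
    intro G
    -- `G = A ± B` on the two halves
    set A : (Fin n → Bool) → ℝ := fun w => (G (insertBit 0 true w) + G (insertBit 0 false w)) / 2
    set B : (Fin n → Bool) → ℝ := fun w => (G (insertBit 0 true w) - G (insertBit 0 false w)) / 2
    have hA := ih A
    have hB := poincare B
    have g1 : ∀ w, G (insertBit 0 true w) = A w + B w := fun w => by simp only [A, B]; ring
    have g0 : ∀ w, G (insertBit 0 false w) = A w - B w := fun w => by simp only [A, B]; ring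
    have s1 : ∑ v, G v = 2 * ∑ w, A w := by
      rw [sum_eq_sum_insertBit 0, ← Finset.sum_add_distrib, Finset.mul_sum]
      exact Finset.sum_congr rfl fun w _ => by rw [g1, g0]; ring
    have s2 : ∑ v, G v ^ 2 = 2 * ∑ w, A w ^ 2 + 2 * ∑ w, B w ^ 2 := by
      rw [sum_eq_sum_insertBit 0, ← Finset.sum_add_distrib, Finset.mul_sum, Finset.mul_sum,
        ← Finset.sum_add_distrib]
      exact Finset.sum_congr rfl fun w _ => by rw [g1, g0]; ring
    have s3 : ∑ v, (bitSign v 0 : ℝ) * G v = 2 * ∑ w, B w := by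
      rw [sum_eq_sum_insertBit 0, ← Finset.sum_add_distrib, Finset.mul_sum]
      exact Finset.sum_congr rfl fun w _ => by rw [g1, g0]; simp [bitSign]; ring
    have s4 : ∀ i : Fin n, ∑ v, (bitSign v i.succ : ℝ) * G v = 2 * ∑ w, bitSign w i * A w := by
      intro i
      have e : ∀ b w, bitSign (insertBit 0 b w) i.succ = bitSign w i := fun b w => by
        have := insertBit_apply_succAbove 0 b w i
        rw [Fin.succAbove_zero] at this
        simp [bitSign, this]
      rw [sum_eq_sum_insertBit 0, ← Finset.sum_add_distrib, Finset.mul_sum]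
      exact Finset.sum_congr rfl fun w _ => by rw [g1, g0, e, e]; ring
    have s5 : ∑ j, ∑ v, (G v - G (flipBit v j)) ^ 2 = 8 * ∑ w, B w ^ 2 +
        (2 * ∑ j, ∑ v, (A v - A (flipBit v j)) ^ 2 +
          2 * ∑ j, ∑ v, (B v - B (flipBit v j)) ^ 2) := by
      rw [sum_flipBit_eq_insertBit 0 fun u v => (G u - G v) ^ 2, ← Finset.sum_add_distrib,
        ← Finset.sum_add_distrib]
      congr 1
      · rw [Finset.mul_sum]
        exact Finset.sum_congr rfl fun w _ => by rw [g1, g0]; ring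
      · rw [Finset.mul_sum, Finset.mul_sum, ← Finset.sum_add_distrib]
        refine Finset.sum_congr rfl fun j _ => ?_
        rw [← Finset.sum_add_distrib, Finset.mul_sum, Finset.mul_sum, ← Finset.sum_add_distrib]
        exact Finset.sum_congr rfl fun w _ => by rw [g1, g0, g1, g0]; ring
    rw [Fin.sum_univ_succ, s1, s2, s3, s5]
    simp only [s4]
    have e1 : (2 * ∑ w, A w) ^ 2 / 2 ^ (n + 1) = 2 * ((∑ w, A w) ^ 2 / 2 ^ n) := by
      rw [pow_succ]; field_simp; ring
    have e2 : (2 * ∑ w, B w) ^ 2 / 2 ^ (n + 1) = 2 * ((∑ w, B w) ^ 2 / 2 ^ n) := by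
      rw [pow_succ]; field_simp; ring
    have e3 : ∑ i, (2 * ∑ w, (bitSign w i : ℝ) * A w) ^ 2 / 2 ^ (n + 1) =
        2 * ∑ i, (∑ w, (bitSign w i : ℝ) * A w) ^ 2 / 2 ^ n := by
      rw [Finset.mul_sum]
      refine Finset.sum_congr rfl fun i _ => ?_
      rw [pow_succ]; field_simp; ring
    rw [e1, e2, e3]
    linarith

end Isoperimetry

/-! ### Sets of half the vertices -/

section HalfSets

variable {n k : ℕ}

theorem sum_bitSign_mul (i : Fin (n + 1)) (F : (Fin (n + 1) → Bool) → ℤ) :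
    ∑ v, bitSign v i * F v = ∑ w, F (insertBit i true w) - ∑ w, F (insertBit i false w) := by
  rw [sum_eq_sum_insertBit i]
  simp [bitSign]
  ring

theorem bitSign_flipBit_same (v : Fin n → Bool) (i : Fin n) :
    bitSign (flipBit v i) i = -bitSign v i := by
  cases h : v i <;> simp [bitSign, h]

theorem bitSign_flipBit_of_ne (v : Fin n → Bool) {i j : Fin n} (h : i ≠ j) :
    bitSign (flipBit v j) i = bitSign v i := by
  simp [bitSign, flipBit_apply_of_ne v h]

theorem bitSign_eq (v : Fin n → Bool) (i : Fin n) : bitSign v i = 1 ∨ bitSign v i = -1 := by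
  cases h : v i <;> simp [bitSign, h]

theorem sum_bitSign (i : Fin n) : ∑ v : Fin n → Bool, bitSign v i = 0 := by
  have h := sum_flipBit (fun v => bitSign v i) i
  simp only [bitSign_flipBit_same, Finset.sum_neg_distrib] at h
  omega

theorem sum_bitSign_mul_bitSign {i j : Fin n} (hij : i ≠ j) :
    ∑ v : Fin n → Bool, bitSign v i * bitSign v j = 0 := by
  have h := sum_flipBit (fun v => bitSign v i * bitSign v j) j
  simp only [bitSign_flipBit_same, bitSign_flipBit_of_ne _ hij, mul_neg,
    Finset.sum_neg_distrib] at h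
  omega

/-- For a set of half the vertices of `Q_{k+2}`: the excess, over one half, of the number of its
elements with `i`-th bit `1`. -/
def bias (F : (Fin (k + 2) → Bool) → ℤ) (i : Fin (k + 2)) : ℤ :=
  ∑ w, F (insertBit i true w) - 2 ^ k

/-- The indicator function of a set of half the vertices of `Q_{k+2}`. -/
structure IsHalf (F : (Fin (k + 2) → Bool) → ℤ) : Prop where
  indicator : ∀ v, F v = 0 ∨ F v = 1
  sum_eq : ∑ v, F v = 2 * 2 ^ k

namespace IsHalf

variable {F : (Fin (k + 2) → Bool) → ℤ}

theorem sum_insertBit_true (F : (Fin (k + 2) → Bool) → ℤ) (i : Fin (k + 2)) :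
    ∑ w, F (insertBit i true w) = 2 ^ k + bias F i := by
  rw [bias]; ring

theorem sum_insertBit_false (hF : IsHalf F) (i : Fin (k + 2)) :
    ∑ w, F (insertBit i false w) = 2 ^ k - bias F i := by
  have := hF.sum_eq
  rw [sum_eq_sum_insertBit i, sum_insertBit_true] at this
  linarith

theorem sum_bitSign_mul_eq (hF : IsHalf F) (i : Fin (k + 2)) :
    ∑ v, bitSign v i * F v = 2 * bias F i := by
  rw [sum_bitSign_mul, sum_insertBit_true, hF.sum_insertBit_false]
  ring

theorem abs_bias_le (hF : IsHalf F) (i : Fin (k + 2)) : |bias F i| ≤ 2 ^ k := by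
  have h1 := sum_indicator_nonneg (F := fun w => F (insertBit i true w)) fun w => hF.indicator _
  have h2 := sum_indicator_nonneg (F := fun w => F (insertBit i false w)) fun w => hF.indicator _
  rw [sum_insertBit_true] at h1
  rw [hF.sum_insertBit_false] at h2
  rw [abs_le]
  constructor <;> linarith

/-- The edge boundary of a half-size set in terms of its distance from a subcube. -/
theorem le_dirBoundary (hF : IsHalf F) (i : Fin (k + 2)) :
    4 * 2 ^ k + 4 * minBoundary k |bias F i| ≤ dirBoundary F := by
  have h := dirBoundary_split_le i F
  have h0 := two_mul_minBoundary_le (F := fun w => F (insertBit i false w)) fun w => hF.indicator _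
  have h1 := two_mul_minBoundary_le (F := fun w => F (insertBit i true w)) fun w => hF.indicator _
  rw [sum_insertBit_true] at h h1
  rw [hF.sum_insertBit_false] at h h0
  have key : ∀ g : ℤ, 0 ≤ g → g ≤ 2 ^ k → minBoundary (k + 1) (2 ^ k + g) +
      minBoundary (k + 1) (2 ^ k - g) = 2 * minBoundary k g + 2 * 2 ^ k - 2 * g := by
    intro g hg hg'
    rw [minBoundary.of_ge (by omega), minBoundary.of_le (by omega), minBoundary.symm hg hg',
      add_sub_cancel_left, pow_succ]
    ring
  have hb := hF.abs_bias_le i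
  rcases abs_cases (bias F i) with ⟨e, hg⟩ | ⟨e, hg⟩
  · have := key (bias F i) hg (by omega)
    rw [e]
    rw [show (2 : ℤ) ^ k - bias F i - (2 ^ k + bias F i) = -(2 * bias F i) by ring, abs_neg,
      abs_mul, e, abs_two] at h
    linarith
  · have := key (-bias F i) (by omega) (by omega)
    rw [sub_neg_eq_add, ← sub_eq_add_neg] at this
    rw [e]
    rw [show (2 : ℤ) ^ k - bias F i - (2 ^ k + bias F i) = -(2 * bias F i) by ring, abs_neg,
      abs_mul, e, abs_two] at h
    linarith

/-- A half-size set cannot be close to subcubes of two different directions. -/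
theorem abs_bias_add_abs_bias_le (hF : IsHalf F) {i j : Fin (k + 2)} (hij : i ≠ j) :
    |bias F i| + |bias F j| ≤ 2 ^ k := by
  have key : ∀ s t : ℤ, (s = 1 ∨ s = -1) → (t = 1 ∨ t = -1) →
      s * bias F i + t * bias F j ≤ 2 ^ k := by
    intro s t hs ht
    have h1 : ∀ v, 2 * (F v * (s * bitSign v i + t * bitSign v j)) ≤
        1 + s * bitSign v i + t * bitSign v j + s * t * (bitSign v i * bitSign v j) := by
      intro v
      rcases hF.indicator v with h | h <;> rcases hs with rfl | rfl <;>
        rcases ht with rfl | rfl <;> rcases bitSign_eq v i with e | e <;>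
        rcases bitSign_eq v j with e' | e' <;> rw [h, e, e'] <;> norm_num
    have h2 := Finset.sum_le_sum fun v (_ : v ∈ Finset.univ) => h1 v
    have e : ∀ v, F v * (s * bitSign v i + t * bitSign v j) =
        s * (bitSign v i * F v) + t * (bitSign v j * F v) := fun v => by ring
    simp only [e, Finset.sum_add_distrib, ← Finset.mul_sum, hF.sum_bitSign_mul_eq, sum_bitSign,
      sum_bitSign_mul_bitSign hij] at h2
    simp [pow_succ] at h2
    linarith
  have h1 := key 1 1 (by simp) (by simp)
  have h2 := key 1 (-1) (by simp) (by simp)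
  have h3 := key (-1) 1 (by simp) (by simp)
  have h4 := key (-1) (-1) (by simp) (by simp)
  rcases abs_cases (bias F i) with ⟨e, _⟩ | ⟨e, _⟩ <;>
    rcases abs_cases (bias F j) with ⟨e', _⟩ | ⟨e', _⟩ <;> rw [e, e'] <;> linarith

/-- In each direction `i`, the boundary is at least the absolute value of the Walsh coefficient. -/
theorem four_mul_sum_abs_bias_le (hF : IsHalf F) : 4 * ∑ i, |bias F i| ≤ dirBoundary F := by
  rw [dirBoundary, Finset.mul_sum]
  refine Finset.sum_le_sum fun i _ => ?_
  have e : ∑ v, bitSign v i * (F v - F (flipBit v i)) = 4 * bias F i := by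
    have h := sum_flipBit (fun v => bitSign v i * F v) i
    simp only [bitSign_flipBit_same, neg_mul, Finset.sum_neg_distrib] at h
    simp only [mul_sub, Finset.sum_sub_distrib, hF.sum_bitSign_mul_eq] at h ⊢
    linarith
  calc 4 * |bias F i| = |∑ v, bitSign v i * (F v - F (flipBit v i))| := by
        rw [e, abs_mul]; norm_num
    _ ≤ ∑ v, |bitSign v i * (F v - F (flipBit v i))| := Finset.abs_sum_le_sum_abs _ _
    _ = ∑ v, |F v - F (flipBit v i)| := by
        refine Finset.sum_congr rfl fun v _ => ?_
        rw [abs_mul]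
        rcases bitSign_eq v i with h | h <;> rw [h] <;> norm_num

/-- A half-size set that is not close to any subcube of codimension `1` has an edge boundary at
least `3/2` times the minimum. -/
theorem six_mul_le_dirBoundary (hF : IsHalf F) (h : ∀ i, 2 * |bias F i| ≤ 2 ^ k) :
    6 * 2 ^ k ≤ dirBoundary F := by
  by_cases hi : ∃ i, 2 ^ k ≤ 4 * |bias F i|
  · obtain ⟨i, hi⟩ := hi
    have h1 := hF.le_dirBoundary i
    have h2 := minBoundary.two_pow_le_two_mul hi (by have := h i; omega)
    omega
  · -- all Walsh coefficients of degree `1` are small, so the degree is at least `2` on average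
    push Not at hi
    have hP := poincare_second_order fun v => (2 * F v - 1 : ℝ)
    have e1 : ∀ v, (2 * F v - 1 : ℝ) ^ 2 = 1 := by
      intro v
      rcases hF.indicator v with h | h <;> rw [h] <;> norm_num
    have e2 : ∑ v, (2 * F v - 1 : ℝ) = 0 := by
      have : ∑ v, (F v : ℝ) = 2 * 2 ^ k := by exact_mod_cast hF.sum_eq
      rw [Finset.sum_sub_distrib, ← Finset.mul_sum, this]
      simp [pow_succ]
      ring
    have e3 : ∀ i, ∑ v, (bitSign v i : ℝ) * (2 * F v - 1) = 4 * bias F i := by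
      intro i
      have h1 : ∑ v, (bitSign v i : ℝ) * F v = 2 * bias F i := by
        exact_mod_cast hF.sum_bitSign_mul_eq i
      have h2 : ∑ v : Fin (k + 2) → Bool, (bitSign v i : ℝ) = 0 := by
        exact_mod_cast sum_bitSign i
      have : ∀ v, (bitSign v i : ℝ) * (2 * F v - 1) = 2 * (bitSign v i * F v) - bitSign v i :=
        fun v => by ring
      simp only [this, Finset.sum_sub_distrib, ← Finset.mul_sum, h1, h2]
      ring
    have e4 : ∀ u v, ((2 * F u - 1 : ℝ) - (2 * F v - 1)) ^ 2 = 4 * ((|F u - F v| : ℤ) : ℝ) := by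
      intro u v
      rcases hF.indicator u with h | h <;> rcases hF.indicator v with h' | h' <;>
        rw [h, h'] <;> norm_num
    simp only [e1, e2, e3, e4, ← Finset.mul_sum] at hP
    have e5 : ∑ j, ∑ v, ((|F v - F (flipBit v j)| : ℤ) : ℝ) = (dirBoundary F : ℝ) := by
      rw [dirBoundary]; push_cast; rfl
    rw [e5] at hP
    have hN : (0 : ℝ) < 2 ^ k := by positivity
    have h1 : ∀ i, (4 * (bias F i : ℝ)) ^ 2 / 2 ^ (k + 2) ≤ ((|bias F i| : ℤ) : ℝ) := by
      intro i
      have : (4 * ((|bias F i| : ℤ) : ℝ)) ≤ 2 ^ k := by exact_mod_cast (hi i).le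
      push_cast at this ⊢
      rw [div_le_iff₀ (by positivity), mul_pow, ← sq_abs (bias F i : ℝ), pow_succ 2 (k + 1),
        pow_succ 2 k]
      nlinarith [abs_nonneg (bias F i : ℝ)]
    have h2 := Finset.sum_le_sum fun i (_ : i ∈ Finset.univ) => h1 i
    have h3 : (4 * ∑ i, ((|bias F i| : ℤ) : ℝ)) ≤ dirBoundary F := by
      exact_mod_cast hF.four_mul_sum_abs_bias_le
    simp [pow_succ] at hP h2 h3
    have : (6 * 2 ^ k : ℝ) ≤ dirBoundary F := by linarith
    exact_mod_cast this

end IsHalf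

end HalfSets

/-! ### Functions on a cyclic time axis -/

section Cyclic

/-- A discrete intermediate value theorem. -/
theorem exists_eq_of_le_of_lt {φ : ℕ → ℤ} (hstep : ∀ a, φ a - 1 ≤ φ (a + 1)) {u : ℤ} {m : ℕ}
    (h0 : u < φ 0) (hm : φ m < u) : ∃ a, 0 < a ∧ a < m ∧ φ a = u := by
  have hex : ∃ a, φ a ≤ u := ⟨m, hm.le⟩
  have h1 := Nat.find_spec hex
  have h2 : Nat.find hex ≠ 0 := fun h => by rw [h] at h1; omega
  obtain ⟨a, ha⟩ := Nat.exists_eq_succ_of_ne_zero h2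
  have h3 := Nat.find_min hex (m := a) (by omega)
  have h4 := hstep a
  rw [ha, Nat.succ_eq_add_one] at h1
  have h5 : φ (a + 1) = u := by omega
  refine ⟨a + 1, by omega, ?_, h5⟩
  have h6 : a + 1 ≤ m := by
    rw [← Nat.succ_eq_add_one, ← ha]
    exact Nat.find_min' hex hm.le
  rcases h6.lt_or_eq with h | rfl
  · exact h
  · omega

variable {k : ℕ}

theorem natCast_ne_neg_natCast {N a b : ℕ} (ha : 0 < a) (hab : a + b < N) :
    (a : ZMod N) ≠ -(b : ZMod N) := by
  intro h
  have : ((a + b : ℕ) : ZMod N) = 0 := by push_cast; rw [h]; ring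
  rw [ZMod.natCast_eq_zero_iff] at this
  exact absurd (Nat.le_of_dvd (by omega) this) (by omega)

/-- A set of times that are pairwise close has few elements. -/
theorem card_le_of_forall_add {N m : ℕ} [NeZero N] (hN : 4 * m + 4 < N) {J : Finset (ZMod N)}
    (hJ : ∀ t ∈ J, ∀ j : ℕ, 2 * j ≤ N → t + j ∈ J → j ≤ m) : J.card ≤ m + 1 := by
  classical
  rcases J.eq_empty_or_nonempty with rfl | ⟨t₀, ht₀⟩
  · simp
  -- positions relative to `t₀`
  let c : ZMod N → ℤ := fun t => (t - t₀).valMinAbs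
  have hc : ∀ t, t = t₀ + (c t : ZMod N) := fun t => by
    simp only [c, ZMod.coe_valMinAbs]; ring
  have hinj : Function.Injective c := fun a b h => by rw [hc a, hc b, h]
  have hdiff : ∀ s t : ZMod N, ∀ j : ℕ, c t - c s = j → t = s + j := by
    intro s t j h
    have h1 : (c t : ZMod N) = c s + j := by
      rw [show c t = c s + j by omega]
      push_cast
      rfl
    linear_combination hc t - hc s + h1
  have hc0 : c t₀ = 0 := by simp [c]
  have hle : ∀ t, 2 * |c t| ≤ N := by
    intro t
    have h1 := ZMod.natAbs_valMinAbs_le (t - t₀)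
    have h2 : |c t| = (c t).natAbs := Int.abs_eq_natAbs _
    rw [h2]
    have : (c t).natAbs ≤ N / 2 := h1
    omega
  have hbd : ∀ t ∈ J, |c t| ≤ m := by
    intro t ht
    have h2 := hle t
    rcases abs_cases (c t) with ⟨e, h0⟩ | ⟨e, h0⟩ <;> rw [e] at h2 ⊢
    · obtain ⟨j, hj⟩ := Int.eq_ofNat_of_zero_le h0
      have := hJ t₀ ht₀ j (by omega) (hdiff t₀ t j (by omega) ▸ ht)
      omega
    · obtain ⟨j, hj⟩ := Int.eq_ofNat_of_zero_le (show 0 ≤ -c t by omega)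
      have := hJ t ht j (by omega) (hdiff t t₀ j (by omega) ▸ ht₀)
      omega
  obtain ⟨s, hs, hmin⟩ := Finset.exists_min_image J c ⟨t₀, ht₀⟩
  have hsub : J.image c ⊆ Finset.Icc (c s) (c s + m) := by
    intro x hx
    obtain ⟨t, ht, rfl⟩ := Finset.mem_image.1 hx
    have h1 := hmin t ht
    obtain ⟨j, hj⟩ := Int.eq_ofNat_of_zero_le (show 0 ≤ c t - c s by omega)
    have h2 := hbd t ht
    have h3 := hbd s hs
    rw [abs_le] at h2 h3
    have := hJ s hs j (by omega) (hdiff s t j (by omega) ▸ ht)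
    rw [Finset.mem_Icc]
    omega
  have := Finset.card_le_card hsub
  rw [Finset.card_image_of_injective _ hinj, Int.card_Icc] at this
  omega

/-- A function on the cyclic time axis `ℤ / 2^(k+3)` with the properties of the bias, in one
direction, of the half-arcs of a cyclic numbering of `Q_{k+3}`. The condition `add_le` holds there
because the half-arcs starting at `t` and `t + j` have only `2 ^ (k + 2) - j` common vertices. -/
structure IsBiasFunction (G : ZMod (2 ^ (k + 3)) → ℤ) : Prop where
  le : ∀ t, G t ≤ 2 ^ (k + 1)
  step : ∀ t, |G (t + 1) - G t| ≤ 1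
  antiperiodic : ∀ t, G (t + 2 ^ (k + 2)) = -G t
  add_le : ∀ t, ∀ j : ℕ, j ≤ 2 ^ (k + 2) → G t + G (t + j) ≤ 2 ^ (k + 2) - j

namespace IsBiasFunction

variable {G : ZMod (2 ^ (k + 3)) → ℤ}

theorem sub_antiperiodic (hG : IsBiasFunction G) (t : ZMod (2 ^ (k + 3))) :
    G (t - 2 ^ (k + 2)) = -G t := by
  have := hG.antiperiodic (t - 2 ^ (k + 2))
  rw [sub_add_cancel] at this
  omega

theorem neg (hG : IsBiasFunction G) : IsBiasFunction fun t => -G t where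
  le t := by rw [← hG.antiperiodic]; exact hG.le _
  step t := by
    have := hG.step t
    rw [abs_sub_comm] at this
    rwa [neg_sub_neg]
  antiperiodic t := by rw [hG.antiperiodic]
  add_le t j hj := by
    have := hG.add_le (t + 2 ^ (k + 2)) j hj
    rwa [add_right_comm, hG.antiperiodic, hG.antiperiodic] at this

/-- The times at which the half-arc is closer to the given half cube than to all others. -/
def near (G : ZMod (2 ^ (k + 3)) → ℤ) : Finset (ZMod (2 ^ (k + 3))) :=
  Finset.univ.filter fun t => 2 ^ k < G t

theorem mem_near {t : ZMod (2 ^ (k + 3))} : t ∈ near G ↔ 2 ^ k < G t := by simp [near]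

theorem card_near_le (hG : IsBiasFunction G) : (near G).card ≤ 2 ^ (k + 1) - 1 := by
  have h1 : 1 ≤ 2 ^ k := Nat.one_le_two_pow
  have e1 : 2 ^ (k + 1) = 2 * 2 ^ k := by ring
  have e2 : 2 ^ (k + 2) = 4 * 2 ^ k := by ring
  have e3 : 2 ^ (k + 3) = 8 * 2 ^ k := by ring
  have := card_le_of_forall_add (m := 2 * 2 ^ k - 2) (by omega) (J := near G) ?_
  · omega
  intro t ht j hj hj'
  rw [mem_near] at ht hj'
  have h2 := hG.add_le t j (by omega)
  have h3 : (1 : ℤ) ≤ 2 ^ k := by exact_mod_cast h1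
  have e2' : (2 : ℤ) ^ (k + 2) = 4 * 2 ^ k := by ring
  zify [show 2 ≤ 2 * 2 ^ k by omega]
  omega

/-- Below its maximum, a bias function takes every positive value both before and after the
maximum. -/
theorem exists_two_times (hG : IsBiasFunction G) {t₀ : ZMod (2 ^ (k + 3))} {u : ℤ} (h0 : 0 < u)
    (hu : u < G t₀) : ∃ s t, s ≠ t ∧ G s = u ∧ G t = u := by
  obtain ⟨a, ha, ha', hGa⟩ := exists_eq_of_le_of_lt (φ := fun a : ℕ => G (t₀ + a))
    (m := 2 ^ (k + 2)) (u := u) (fun a => by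
      have := hG.step (t₀ + a)
      rw [abs_le] at this
      push_cast
      rw [← add_assoc]
      omega) (by simpa using hu) (by
      push_cast
      rw [hG.antiperiodic]
      omega)
  obtain ⟨b, hb, hb', hGb⟩ := exists_eq_of_le_of_lt (φ := fun b : ℕ => G (t₀ - b))
    (m := 2 ^ (k + 2)) (u := u) (fun b => by
      have := hG.step (t₀ - b - 1)
      rw [abs_le, sub_add_cancel] at this
      push_cast
      rw [← sub_sub]
      omega) (by simpa using hu) (by
      push_cast
      rw [hG.sub_antiperiodic]
      omega)
  refine ⟨t₀ + a, t₀ - b, ?_, hGa, hGb⟩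
  rw [sub_eq_add_neg]
  intro h
  refine natCast_ne_neg_natCast ha ?_ (add_left_cancel h)
  have e3 : 2 ^ (k + 3) = 2 ^ (k + 2) + 2 ^ (k + 2) := by ring
  omega

/-- Over the times when the half-arcs are near to a given half cube, the lower bounds that the bias
gives for the excess of their boundaries fall short of an average of `2 ^ (k + 1) - 1` by at most
`1` in total: the time near the half cube is limited, and all the levels below the maximal bias
have to be passed twice. -/
theorem le_sum_near (hG : IsBiasFunction G) (hne : (near G).Nonempty) :
    -1 ≤ ∑ t ∈ near G, (2 * minBoundary (k + 1) |G t| - (2 ^ (k + 1) - 1)) := by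
  classical
  have hpow : (2 : ℤ) ^ (k + 1) = 2 * 2 ^ k := by ring
  have hpow' : 2 ^ (k + 1) = 2 * 2 ^ k := by ring
  have hr1 : 1 ≤ 2 ^ k := Nat.one_le_two_pow
  -- `x t` is the number of vertices that the half-arc has outside the half cube
  let x : ZMod (2 ^ (k + 3)) → ℕ := fun t => (2 ^ (k + 1) - G t).toNat
  have hx : ∀ t, (x t : ℤ) = 2 ^ (k + 1) - G t := fun t =>
    Int.toNat_of_nonneg (by have := hG.le t; omega)
  let w : ℕ → ℤ := fun y => 2 * minBoundary (k + 1) y - (2 ^ (k + 1) - 1)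
  have hw : ∀ t ∈ near G, 2 * minBoundary (k + 1) |G t| - (2 ^ (k + 1) - 1) = w (x t) := by
    intro t ht
    rw [mem_near] at ht
    have h0 : (0 : ℤ) < 2 ^ k := by positivity
    simp only [w]
    rw [hx, minBoundary.symm (by omega) (hG.le t), abs_of_nonneg (by omega)]
  rw [Finset.sum_congr rfl hw]
  obtain ⟨t₀, ht₀, hmax⟩ := Finset.exists_max_image (near G) G hne
  have ht₀' := mem_near.1 ht₀
  set X := x t₀ with hX
  have hX0 : (X : ℤ) = 2 ^ (k + 1) - G t₀ := hx t₀
  have hXr : X < 2 ^ k := by zify; omega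
  -- two times for each level between the extreme one and the boundary
  have hex : ∀ y : ℕ, ∃ p : ZMod (2 ^ (k + 3)) × ZMod (2 ^ (k + 3)),
      y ∈ Finset.Ioo X (2 ^ k) → p.1 ≠ p.2 ∧ x p.1 = y ∧ x p.2 = y := by
    intro y
    by_cases hy : y ∈ Finset.Ioo X (2 ^ k)
    · have hy' := Finset.mem_Ioo.1 hy
      have h1 : (y : ℤ) < 2 ^ k := by exact_mod_cast hy'.2
      obtain ⟨s, t, hst, hs, ht⟩ := hG.exists_two_times (t₀ := t₀) (u := 2 ^ (k + 1) - y)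
        (by omega) (by omega)
      refine ⟨(s, t), fun _ => ⟨hst, ?_, ?_⟩⟩
      · have := hx s; simp only; omega
      · have := hx t; simp only; omega
    · exact ⟨(t₀, t₀), fun h => absurd h hy⟩
  choose p hp using hex
  let K : Finset (ZMod (2 ^ (k + 3))) :=
    (Finset.Ioo X (2 ^ k)).biUnion fun y => {(p y).1, (p y).2}
  have hxK : ∀ y ∈ Finset.Ioo X (2 ^ k), ∀ t ∈ ({(p y).1, (p y).2} : Finset _), x t = y := by
    intro y hy t ht
    rcases Finset.mem_insert.1 ht with rfl | ht
    · exact (hp y hy).2.1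
    · rw [Finset.mem_singleton.1 ht]; exact (hp y hy).2.2
  have hdisj : (Finset.Ioo X (2 ^ k) : Set ℕ).PairwiseDisjoint
      fun y => ({(p y).1, (p y).2} : Finset (ZMod (2 ^ (k + 3)))) := by
    intro y hy y' hy' hyy'
    refine Finset.disjoint_left.2 fun t ht ht' => hyy' ?_
    rw [← hxK y hy t ht, hxK y' hy' t ht']
  have hKsub : K ⊆ near G := by
    intro t ht
    obtain ⟨y, hy, ht⟩ := Finset.mem_biUnion.1 ht
    have h1 := hxK y hy t ht
    have h2 := (Finset.mem_Ioo.1 hy).2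
    have h3 := hx t
    rw [mem_near]
    zify at h1 h2
    omega
  have hKcard : K.card = 2 * (2 ^ k - 1 - X) := by
    rw [Finset.card_biUnion hdisj,
      Finset.sum_congr rfl fun y hy => Finset.card_pair (hp y hy).1, Finset.sum_const,
      Nat.card_Ioo, smul_eq_mul, mul_comm]
    omega
  have hKsum : ∑ t ∈ K, w (x t) = ∑ y ∈ Finset.Ioo X (2 ^ k), 2 * w y := by
    rw [Finset.sum_biUnion hdisj]
    refine Finset.sum_congr rfl fun y hy => ?_
    rw [Finset.sum_pair (hp y hy).1, (hp y hy).2.1, (hp y hy).2.2, two_mul]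
  -- `U` is the contribution of the levels up to `X` when they are passed twice, and `0` once
  set U : ℤ := 4 * ∑ y ∈ Finset.range (X + 1), minBoundary (k + 1) y -
    (2 * X + 1) * (2 ^ (k + 1) - 1) with hU
  have hU0 : U ≤ 0 := by
    have := minBoundary.sum_range_succ_le k X hXr
    omega
  have hrest : ∀ t ∈ near G \ K, U ≤ (2 * X + 1) * w (x t) := by
    intro t ht
    have ht := (Finset.mem_sdiff.1 ht).1
    have h1 := hmax t ht
    have h2 := hx t
    have h3 := mem_near.1 ht
    have := minBoundary.sum_range_succ_le_mul k X (x t) (by omega) (by zify; omega)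
    simp only [hU, w]
    linarith
  have hcard : ((near G \ K).card : ℤ) ≤ 2 * X + 1 := by
    rw [Finset.card_sdiff_of_subset hKsub, hKcard]
    have := hG.card_near_le
    omega
  have hrest' : U ≤ ∑ t ∈ near G \ K, w (x t) := by
    have h1 := Finset.sum_le_sum hrest
    rw [Finset.sum_const, nsmul_eq_mul, ← Finset.mul_sum] at h1
    have h2 : (0 : ℤ) < 2 * X + 1 := by positivity
    refine le_of_mul_le_mul_left (le_trans ?_ h1) h2
    exact mul_le_mul_of_nonpos_right hcard hU0
  have htotal := minBoundary.sum_range_half k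
  have hsplit : ∑ y ∈ Finset.range (2 ^ k), minBoundary (k + 1) y =
      ∑ y ∈ Finset.range (X + 1), minBoundary (k + 1) y +
        ∑ y ∈ Finset.Ioo X (2 ^ k), minBoundary (k + 1) y := by
    rw [← Finset.sum_range_add_sum_Ico _ (show X + 1 ≤ 2 ^ k by omega)]
    congr 2
  have hIoo : ∑ y ∈ Finset.Ioo X (2 ^ k), 2 * w y =
      4 * ∑ y ∈ Finset.Ioo X (2 ^ k), minBoundary (k + 1) y -
        2 * (2 ^ k - 1 - X) * (2 ^ (k + 1) - 1) := by
    rw [← Finset.mul_sum]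
    simp only [w, Finset.sum_sub_distrib, Finset.sum_const, Nat.card_Ioo, nsmul_eq_mul,
      ← Finset.mul_sum]
    rw [Nat.cast_sub (by omega), Nat.cast_sub (by omega)]
    push_cast
    ring
  rw [← Finset.sum_sdiff hKsub, hKsum, hIoo]
  have h4 : (4 : ℤ) ^ (k + 1) = 4 * (2 ^ k * 2 ^ k) := by
    rw [pow_succ, ← mul_pow]; norm_num; ring
  rw [hsplit, h4] at htotal
  rw [hpow] at htotal hU ⊢
  linarith

/-- The set of times near a half cube has a last element before a gap. -/
theorem exists_last (hG : IsBiasFunction G) (hne : (near G).Nonempty) :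
    ∃ t ∈ near G, t + 1 ∉ near G := by
  by_contra! h
  obtain ⟨t, ht⟩ := hne
  have hall : ∀ a : ℕ, t + a ∈ near G := by
    intro a
    induction a with
    | zero => simpa using ht
    | succ a ih => push_cast; rw [← add_assoc]; exact h _ ih
  have h1 := mem_near.1 (hall (2 ^ (k + 2)))
  rw [mem_near] at ht
  push_cast at h1
  rw [hG.antiperiodic] at h1
  have : (0 : ℤ) < 2 ^ k := by positivity
  omega

end IsBiasFunction

/-- A function on the cyclic time axis that satisfies, with respect to a family of bias functions,
the lower bounds for the excess of the boundaries of the half-arcs has an average of at least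
`2 ^ (k + 1) - 1`: the deficit of `1` from the times near a half cube is made up for by the surplus
of `1` in the gap after them. -/
theorem le_sum_of_isBiasFunction {ι : Type*} [Fintype ι] {g : ι → ZMod (2 ^ (k + 3)) → ℤ}
    {h : ZMod (2 ^ (k + 3)) → ℤ} (hg : ∀ i, IsBiasFunction (g i))
    (hadd : ∀ i j, i ≠ j → ∀ t, |g i t| + |g j t| ≤ 2 ^ (k + 1))
    (hh : ∀ i t, 2 * minBoundary (k + 1) |g i t| ≤ h t)
    (hfar : ∀ t, (∀ i, |g i t| ≤ 2 ^ k) → 2 ^ (k + 1) ≤ h t) :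
    2 ^ (k + 3) * (2 ^ (k + 1) - 1) ≤ ∑ t, h t := by
  classical
  have hr1 : (1 : ℤ) ≤ 2 ^ k := by exact_mod_cast Nat.one_le_two_pow
  have hpow : (2 : ℤ) ^ (k + 1) = 2 * 2 ^ k := by ring
  -- the half cubes are given by a direction and a sign
  let G : ι × Bool → ZMod (2 ^ (k + 3)) → ℤ := fun κ t => if κ.2 then g κ.1 t else -g κ.1 t
  have hGabs : ∀ κ t, |G κ t| = |g κ.1 t| := by
    rintro ⟨i, b⟩ t
    cases b <;> simp [G]
  have hG : ∀ κ, IsBiasFunction (G κ) := by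
    rintro ⟨i, b⟩
    cases b
    · simpa [G] using (hg i).neg
    · simpa [G] using hg i
  -- no two half cubes can be near at the same time or at successive times
  have hsep : ∀ κ κ', κ ≠ κ' → ∀ t, 2 ^ k < G κ t → 2 ^ k ≤ G κ' t → False := by
    rintro ⟨i, b⟩ ⟨j, c⟩ hne t h1 h2
    by_cases hij : i = j
    · subst hij
      have hbc : b ≠ c := fun e => hne (by rw [e])
      cases b <;> cases c <;> simp [G] at hbc h1 h2 <;> omega
    · have h3 := hadd i j hij t
      rw [← hGabs (i, b), ← hGabs (j, c)] at h3
      have h4 := le_abs_self (G (i, b) t)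
      have h5 := le_abs_self (G (j, c) t)
      omega
  have hsucc : ∀ κ κ', ∀ t ∈ IsBiasFunction.near (G κ), t + 1 ∉ IsBiasFunction.near (G κ) →
      t + 1 ∉ IsBiasFunction.near (G κ') := by
    intro κ κ' t ht ht' h1
    have hne : κ ≠ κ' := fun e => ht' (e ▸ h1)
    rw [IsBiasFunction.mem_near] at ht h1
    have h2 := (abs_le.1 ((hG κ').step t)).2
    exact hsep κ κ' hne t ht (by omega)
  have hlast : ∀ κ, ∃ e, (IsBiasFunction.near (G κ)).Nonempty →
      e ∈ IsBiasFunction.near (G κ) ∧ e + 1 ∉ IsBiasFunction.near (G κ) := by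
    intro κ
    by_cases hne : (IsBiasFunction.near (G κ)).Nonempty
    · obtain ⟨e, he⟩ := (hG κ).exists_last hne
      exact ⟨e, fun _ => he⟩
    · exact ⟨0, fun h => absurd h hne⟩
  choose e he using hlast
  let C : Finset (ι × Bool) := Finset.univ.filter fun κ => (IsBiasFunction.near (G κ)).Nonempty
  have hC : ∀ κ ∈ C, (IsBiasFunction.near (G κ)).Nonempty := fun κ hκ => (Finset.mem_filter.1 hκ).2
  -- a time that is near to no half cube
  have hfar' : ∀ t, (∀ κ, t ∉ IsBiasFunction.near (G κ)) → 2 ^ (k + 1) ≤ h t := by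
    intro t ht
    refine hfar t fun i => ?_
    have h1 := ht (i, true)
    have h2 := ht (i, false)
    simp only [IsBiasFunction.mem_near, G, if_true, Bool.false_eq_true, if_false] at h1 h2
    rw [abs_le]
    omega
  let J : ι × Bool → Finset (ZMod (2 ^ (k + 3))) := fun κ =>
    insert (e κ + 1) (IsBiasFunction.near (G κ))
  have hJ : ∀ κ ∈ C, 0 ≤ ∑ t ∈ J κ, (h t - (2 ^ (k + 1) - 1)) := by
    intro κ hκ
    have hne := hC κ hκ
    obtain ⟨h1, h2⟩ := he κ hne
    rw [Finset.sum_insert h2]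
    have h3 := (hG κ).le_sum_near hne
    have h4 : ∑ t ∈ IsBiasFunction.near (G κ),
        (2 * minBoundary (k + 1) |G κ t| - (2 ^ (k + 1) - 1)) ≤
        ∑ t ∈ IsBiasFunction.near (G κ), (h t - (2 ^ (k + 1) - 1)) :=
      Finset.sum_le_sum fun t _ => by
        have := hh κ.1 t
        rw [hGabs]
        omega
    have h5 := hfar' (e κ + 1) fun κ' => hsucc κ κ' (e κ) h1 h2
    omega
  have hdisj : (C : Set (ι × Bool)).PairwiseDisjoint J := by
    intro κ hκ κ' hκ' hne
    obtain ⟨h1, h2⟩ := he κ (hC κ hκ)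
    obtain ⟨h1', h2'⟩ := he κ' (hC κ' hκ')
    refine Finset.disjoint_left.2 fun t ht ht' => ?_
    rcases Finset.mem_insert.1 ht with rfl | ht <;> rcases Finset.mem_insert.1 ht' with h | ht'
    · rw [add_right_cancel h, IsBiasFunction.mem_near] at h1
      rw [IsBiasFunction.mem_near] at h1'
      exact hsep κ κ' hne _ h1 h1'.le
    · exact hsucc κ κ' _ h1 h2 ht'
    · subst h
      exact hsucc κ' κ _ h1' h2' ht
    · rw [IsBiasFunction.mem_near] at ht ht'
      exact hsep κ κ' hne _ ht ht'.le
  have hsum : 0 ≤ ∑ t, (h t - (2 ^ (k + 1) - 1)) := by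
    rw [← Finset.sum_sdiff (Finset.subset_univ (C.biUnion J)), Finset.sum_biUnion hdisj]
    refine add_nonneg (Finset.sum_nonneg fun t ht => ?_) (Finset.sum_nonneg hJ)
    have : 2 ^ (k + 1) ≤ h t := hfar' t fun κ hκ => (Finset.mem_sdiff.1 ht).2 <|
      Finset.mem_biUnion.2 ⟨κ, Finset.mem_filter.2 ⟨Finset.mem_univ _, ⟨t, hκ⟩⟩,
        Finset.mem_insert_of_mem hκ⟩
    omega
  rw [Finset.sum_sub_distrib, Finset.sum_const, Finset.card_univ, ZMod.card, nsmul_eq_mul] at hsum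
  push_cast at hsum
  linarith

end Cyclic

/-! ### Half-arcs of a cyclic numbering -/

section HalfArc

variable {m : ℕ}

/-- The indicator function of the half-arc `0, 1, …, 2 ^ m - 1` of the cycle `ℤ / 2 ^ (m + 1)`. -/
def halfArc (x : ZMod (2 ^ (m + 1))) : ℤ := if x.val < 2 ^ m then 1 else 0

theorem halfArc_eq (x : ZMod (2 ^ (m + 1))) : halfArc x = 0 ∨ halfArc x = 1 := by
  rw [halfArc]; split_ifs <;> simp

theorem val_two_pow : ((2 : ZMod (2 ^ (m + 1))) ^ m).val = 2 ^ m := by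
  have := ZMod.val_natCast_of_lt (n := 2 ^ (m + 1)) (a := 2 ^ m)
    (Nat.pow_lt_pow_right (by norm_num) (by omega))
  push_cast at this
  exact this

theorem halfArc_add_two_pow (x : ZMod (2 ^ (m + 1))) :
    halfArc (x + 2 ^ m) = 1 - halfArc x := by
  have hp : 2 ^ (m + 1) = 2 ^ m + 2 ^ m := by ring
  have hx := ZMod.val_lt x
  have h2 := val_two_pow (m := m)
  rw [halfArc, halfArc]
  rcases lt_or_ge x.val (2 ^ m) with h | h
  · have := ZMod.val_add_of_lt (a := x) (b := 2 ^ m) (by omega)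
    rw [if_pos h, if_neg (by omega)]
    norm_num
  · have := ZMod.val_add_val_of_le (a := x) (b := 2 ^ m) (by omega)
    rw [if_pos (by omega), if_neg (by omega)]
    norm_num

theorem halfArc_sub_two_pow (x : ZMod (2 ^ (m + 1))) :
    halfArc (x - 2 ^ m) = 1 - halfArc x := by
  have := halfArc_add_two_pow (x - 2 ^ m)
  rw [sub_add_cancel] at this
  omega

theorem halfArc_sub_one (x : ZMod (2 ^ (m + 1))) :
    halfArc (x - 1) - halfArc x = (if x = 2 ^ m then 1 else 0) - (if x = 0 then 1 else 0) := by
  obtain ⟨y, rfl⟩ : ∃ y, x = y + 1 := ⟨x - 1, by ring⟩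
  have hp : 2 ^ (m + 1) = 2 ^ m + 2 ^ m := by ring
  have h0 : 0 < 2 ^ m := by positivity
  have hy := ZMod.val_lt y
  have h2 := val_two_pow (m := m)
  have h1 : (1 : ZMod (2 ^ (m + 1))).val = 1 := by
    have := ZMod.val_natCast_of_lt (n := 2 ^ (m + 1)) (a := 1) (by omega)
    simpa using this
  rw [add_sub_cancel_right, halfArc, halfArc]
  have e1 : (y + 1 = 2 ^ m) ↔ (y + 1).val = 2 ^ m := by
    rw [← h2]
    exact (ZMod.val_injective _).eq_iff.symm
  simp only [e1, ← ZMod.val_eq_zero (y + 1)]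
  rcases lt_or_ge (y.val + 1) (2 ^ (m + 1)) with h | h
  · have := ZMod.val_add_of_lt (a := y) (b := 1) (by omega)
    split_ifs <;> omega
  · have := ZMod.val_add_val_of_le (a := y) (b := 1) (by omega)
    split_ifs <;> omega

theorem sum_halfArc : ∑ x : ZMod (2 ^ (m + 1)), halfArc x = 2 ^ m := by
  have h := Equiv.sum_comp (Equiv.addRight (2 ^ m : ZMod (2 ^ (m + 1)))) halfArc
  simp only [Equiv.coe_addRight, halfArc_add_two_pow, Finset.sum_sub_distrib, Finset.sum_const,
    Finset.card_univ, ZMod.card, nsmul_eq_mul] at h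
  push_cast at h
  rw [pow_succ] at h
  linarith

theorem sum_halfArc_mul_le {j : ℕ} (hj : j ≤ 2 ^ m) :
    ∑ x : ZMod (2 ^ (m + 1)), halfArc x * halfArc (x - (j : ZMod (2 ^ (m + 1)))) ≤ 2 ^ m - j := by
  have hp : 2 ^ (m + 1) = 2 ^ m + 2 ^ m := by ring
  have h0 : 0 < 2 ^ m := by positivity
  have h1 : ∀ x : ZMod (2 ^ (m + 1)), halfArc x *
      halfArc (x - (j : ZMod (2 ^ (m + 1)))) ≤ if x.val ∈ Finset.Ico j (2 ^ m) then 1 else 0 := by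
    intro x
    rw [halfArc, halfArc]
    by_cases hx : x.val < 2 ^ m
    · by_cases hx' : j ≤ x.val
      · rw [if_pos (Finset.mem_Ico.2 ⟨hx', hx⟩)]
        split_ifs <;> norm_num
      · have hjv : ((j : ℕ) : ZMod (2 ^ (m + 1))).val = j := ZMod.val_natCast_of_lt (by omega)
        have h2 : ¬ (x - (j : ZMod (2 ^ (m + 1)))).val < 2 ^ m := by
          intro h3
          have h4 := ZMod.val_add_of_lt (a := x - (j : ZMod (2 ^ (m + 1)))) (b := j)
            (by omega)
          rw [sub_add_cancel] at h4
          omega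
        rw [if_neg h2]
        simp only [mul_zero]
        split_ifs <;> norm_num
    · rw [if_neg hx]
      simp only [zero_mul]
      split_ifs <;> norm_num
  refine (Finset.sum_le_sum fun x _ => h1 x).trans ?_
  rw [Finset.sum_boole]
  have h2 : ((Finset.univ.filter fun x : ZMod (2 ^ (m + 1)) =>
      x.val ∈ Finset.Ico j (2 ^ m)).image ZMod.val) ⊆ Finset.Ico j (2 ^ m) := by
    intro y hy
    obtain ⟨x, hx, rfl⟩ := Finset.mem_image.1 hy
    exact (Finset.mem_filter.1 hx).2
  have h3 := Finset.card_le_card h2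
  rw [Finset.card_image_of_injective _ (ZMod.val_injective _), Nat.card_Ico] at h3
  have h5 := (Nat.cast_le (α := ℤ)).2 h3
  rw [Nat.cast_sub hj] at h5
  push_cast at h5
  exact h5

/-- The number of half-arcs that separate two points. -/
def arcSeparation (a b : ZMod (2 ^ (m + 1))) : ℤ := ∑ t, |halfArc (a - t) - halfArc (b - t)|

theorem arcSeparation_comm (a b : ZMod (2 ^ (m + 1))) :
    arcSeparation a b = arcSeparation b a :=
  Finset.sum_congr rfl fun _ _ => abs_sub_comm _ _

theorem arcSeparation_triangle (a b c : ZMod (2 ^ (m + 1))) :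
    arcSeparation a c ≤ arcSeparation a b + arcSeparation b c := by
  rw [arcSeparation, arcSeparation, arcSeparation, ← Finset.sum_add_distrib]
  exact Finset.sum_le_sum fun t _ => abs_sub_le _ _ _

theorem arcSeparation_add_one (a : ZMod (2 ^ (m + 1))) : arcSeparation a (a + 1) ≤ 2 := by
  have h : ∀ t, |halfArc (a - t) - halfArc (a + 1 - t)| ≤
      (if t = a + 1 - 2 ^ m then 1 else 0) + (if t = a + 1 then 1 else 0) := by
    intro t
    have h1 := halfArc_sub_one (a + 1 - t)
    rw [show a + 1 - t - 1 = a - t by ring] at h1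
    have e1 : a + 1 - t = 2 ^ m ↔ t = a + 1 - 2 ^ m := by
      constructor <;> intro h <;> linear_combination -h
    have e2 : a + 1 - t = 0 ↔ t = a + 1 := by
      constructor <;> intro h <;> linear_combination -h
    simp only [h1, e1, e2]
    split_ifs <;> norm_num
  refine (Finset.sum_le_sum fun t _ => h t).trans ?_
  rw [Finset.sum_add_distrib]
  simp

theorem arcSeparation_add (a : ZMod (2 ^ (m + 1))) (j : ℕ) :
    arcSeparation a (a + (j : ZMod (2 ^ (m + 1)))) ≤ 2 * j := by
  induction j with
  | zero => simp [arcSeparation]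
  | succ j ih =>
    have h1 := arcSeparation_triangle a (a + (j : ZMod (2 ^ (m + 1)))) (a + j + 1)
    have h2 := arcSeparation_add_one (a + (j : ZMod (2 ^ (m + 1))))
    push_cast
    rw [← add_assoc]
    omega

/-- The distance in the cycle with `N` vertices of the positions `a` and `b` in `[0, N]`. -/
def cycleDist (N a b : ℤ) : ℤ := min |a - b| (N - |a - b|)

theorem cycleDist_comm (N a b : ℤ) : cycleDist N a b = cycleDist N b a := by
  rw [cycleDist, cycleDist, abs_sub_comm]

theorem arcSeparation_le {a b : ℕ} (ha : a ≤ 2 ^ (m + 1)) (hb : b ≤ 2 ^ (m + 1)) :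
    arcSeparation (a : ZMod (2 ^ (m + 1))) b ≤ 2 * cycleDist (2 ^ (m + 1)) a b := by
  wlog hab : a ≤ b generalizing a b
  · rw [arcSeparation_comm, cycleDist_comm]
    exact this hb ha (by omega)
  obtain ⟨j, rfl⟩ := Nat.exists_eq_add_of_le hab
  have h1 := arcSeparation_add (a : ZMod (2 ^ (m + 1))) j
  have h2 := arcSeparation_add ((a + j : ℕ) : ZMod (2 ^ (m + 1))) (2 ^ (m + 1) - j)
  have h3 : ((a + j : ℕ) : ZMod (2 ^ (m + 1))) + ((2 ^ (m + 1) - j : ℕ) : ZMod (2 ^ (m + 1))) =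
      a := by
    rw [Nat.cast_sub (by omega), ZMod.natCast_self]
    push_cast
    ring
  rw [h3, arcSeparation_comm, Nat.cast_sub (by omega)] at h2
  have e : |(a : ℤ) - ((a + j : ℕ) : ℤ)| = j := by
    push_cast
    rw [sub_add_cancel_left, abs_neg]
    exact abs_of_nonneg (by positivity)
  rw [cycleDist, e]
  push_cast at h1 h2 ⊢
  rcases min_cases (j : ℤ) (2 ^ (m + 1) - j) with ⟨h, _⟩ | ⟨h, _⟩ <;> rw [h]
  · exact h1
  · exact h2

end HalfArc

/-! ### The lower bound for numberings of the cube along a cycle -/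

section CyclicNumbering

variable {k : ℕ}

theorem sum_comp_numbering {n : ℕ} {f : (Fin n → Bool) → ZMod (2 ^ n)} (hf : f.Bijective)
    (φ : ZMod (2 ^ n) → ℤ) (t : ZMod (2 ^ n)) : ∑ v, φ (f v - t) = ∑ x, φ x := by
  rw [← Equiv.sum_comp (Equiv.subRight t) φ]
  exact hf.sum_comp fun x => φ (x - t)

theorem isHalf_halfArc {f : (Fin (k + 2) → Bool) → ZMod (2 ^ (k + 2))} (hf : f.Bijective)
    (t : ZMod (2 ^ (k + 2))) : IsHalf (k := k) fun v => halfArc (m := k + 1) (f v - t) where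
  indicator _ := halfArc_eq _
  sum_eq := by
    rw [sum_comp_numbering hf (halfArc (m := k + 1)) t, sum_halfArc]
    ring

theorem isBiasFunction_halfArc {f : (Fin (k + 3) → Bool) → ZMod (2 ^ (k + 3))}
    (hf : f.Bijective) (i : Fin (k + 3)) : IsBiasFunction (k := k) fun t =>
      bias (k := k + 1) (fun v => halfArc (m := k + 2) (f v - t)) i := by
  have hinj : ∀ a, 0 ≤ ∑ w, (if f (insertBit i true w) = a then (1 : ℤ) else 0) ∧
      ∑ w, (if f (insertBit i true w) = a then (1 : ℤ) else 0) ≤ 1 := by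
    intro a
    rw [Finset.sum_boole]
    refine ⟨by positivity, ?_⟩
    norm_cast
    refine Finset.card_le_one.2 fun u hu v hv => ?_
    have e := hf.injective ((Finset.mem_filter.1 hu).2.trans (Finset.mem_filter.1 hv).2.symm)
    ext j
    simpa using congrFun e (i.succAbove j)
  refine ⟨fun t => (le_abs_self _).trans ((isHalf_halfArc hf t).abs_bias_le i), fun t => ?_,
    fun t => ?_, fun t j hj => ?_⟩
  · -- one vertex leaves the half-arc and one enters it
    have e : ∀ w, halfArc (m := k + 2) (f (insertBit i true w) - (t + 1)) =
        halfArc (m := k + 2) (f (insertBit i true w) - t) +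
          ((if f (insertBit i true w) = t + 2 ^ (k + 2) then 1 else 0) -
            (if f (insertBit i true w) = t then 1 else 0)) := by
      intro w
      have h1 := halfArc_sub_one (m := k + 2) (f (insertBit i true w) - t)
      simp only [sub_eq_zero (b := t), sub_eq_iff_eq_add' (b := t)] at h1
      rw [← sub_sub, ← h1]
      ring
    simp only [bias, e, Finset.sum_add_distrib, Finset.sum_sub_distrib]
    have h1 := hinj (t + 2 ^ (k + 2))
    have h2 := hinj t
    rw [abs_le]
    constructor <;> linarith
  · have e : ∀ w, halfArc (m := k + 2) (f (insertBit i true w) - (t + 2 ^ (k + 2))) =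
        1 - halfArc (m := k + 2) (f (insertBit i true w) - t) := fun w => by
      rw [← sub_sub, halfArc_sub_two_pow]
    simp only [bias, e, Finset.sum_sub_distrib]
    simp [pow_succ]
    ring
  · have h1 : ∀ w, halfArc (m := k + 2) (f (insertBit i true w) - t) +
        halfArc (m := k + 2) (f (insertBit i true w) - (t + j)) ≤
        1 + halfArc (m := k + 2) (f (insertBit i true w) - t) *
          halfArc (m := k + 2) (f (insertBit i true w) - t - j) := by
      intro w
      rw [← sub_sub]
      rcases halfArc_eq (m := k + 2) (f (insertBit i true w) - t) with h | h <;>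
        rcases halfArc_eq (m := k + 2) (f (insertBit i true w) - t - j) with h' | h' <;>
        rw [h, h'] <;> norm_num
    have h2 := Finset.sum_le_sum fun w (_ : w ∈ Finset.univ) => h1 w
    have h3 := sum_halfArc_mul_le (m := k + 2) hj
    rw [← sum_comp_numbering hf (fun x => halfArc (m := k + 2) x * halfArc (m := k + 2) (x - j)) t,
      sum_eq_sum_insertBit i] at h3
    have h4 : 0 ≤ ∑ w, halfArc (m := k + 2) (f (insertBit i false w) - t) *
        halfArc (m := k + 2) (f (insertBit i false w) - t - j) := by
      refine Finset.sum_nonneg fun w _ => mul_nonneg ?_ ?_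
      · rcases halfArc_eq (m := k + 2) (f (insertBit i false w) - t) with h | h <;> simp [h]
      · rcases halfArc_eq (m := k + 2) (f (insertBit i false w) - t - j) with h | h <;> simp [h]
    simp only [Finset.sum_add_distrib] at h2
    simp [pow_succ] at h2 h3
    simp only [bias, pow_succ]
    linarith

/-- The sum of the edge boundaries of the half-arcs of a cyclic numbering of the cube. -/
theorem le_sum_dirBoundary {f : (Fin (k + 2) → Bool) → ZMod (2 ^ (k + 2))} (hf : f.Bijective) :
    2 * (3 * 4 ^ (k + 1) - 2 ^ (k + 2)) ≤
      ∑ t, dirBoundary fun v => halfArc (m := k + 1) (f v - t) := by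
  cases k with
  | zero =>
    have h := Finset.sum_le_sum fun t (_ : t ∈ Finset.univ) =>
      (isHalf_halfArc (k := 0) hf t).le_dirBoundary 0
    simp [minBoundary] at h
    norm_num
    exact h
  | succ k =>
    set D : ZMod (2 ^ (k + 3)) → ℤ := fun t => dirBoundary fun v => halfArc (m := k + 2) (f v - t)
    have key := le_sum_of_isBiasFunction (k := k)
      (g := fun i t => bias (k := k + 1) (fun v => halfArc (m := k + 2) (f v - t)) i)
      (h := fun t => (D t - 4 * 2 ^ (k + 1)) / 2) (isBiasFunction_halfArc hf)
      (fun i j hij t => (isHalf_halfArc hf t).abs_bias_add_abs_bias_le hij)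
      (fun i t => by
        have := (isHalf_halfArc (k := k + 1) hf t).le_dirBoundary i
        simp only [D]
        omega)
      (fun t ht => by
        have := (isHalf_halfArc (k := k + 1) hf t).six_mul_le_dirBoundary fun i => by
          have := ht i
          have e : (2 : ℤ) ^ (k + 1) = 2 * 2 ^ k := by ring
          omega
        simp only [D]
        omega)
    have h1 : ∑ t, 2 * ((D t - 4 * 2 ^ (k + 1)) / 2) ≤ ∑ t, (D t - 4 * 2 ^ (k + 1)) :=
      Finset.sum_le_sum fun t _ => by omega
    rw [← Finset.mul_sum, Finset.sum_sub_distrib, Finset.sum_const, Finset.card_univ, ZMod.card,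
      nsmul_eq_mul] at h1
    push_cast at h1
    have e1 : (4 : ℤ) ^ (k + 1 + 1) = 4 * (2 ^ (k + 1) * 2 ^ (k + 1)) := by
      rw [← mul_pow, pow_succ]; norm_num; ring
    have e2 : (2 : ℤ) ^ (k + 3) = 4 * 2 ^ (k + 1) := by ring
    rw [e2] at h1 key
    change 2 * (3 * 4 ^ (k + 1 + 1) - 2 ^ (k + 3)) ≤ ∑ t, D t
    rw [e1, e2]
    linarith

/-- The cyclic wirelength (counted twice) of a numbering of the cube. -/
theorem le_sum_cycleDist {f : (Fin (k + 2) → Bool) → ℕ} (hf : f.Injective)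
    (hlt : ∀ v, f v < 2 ^ (k + 2)) :
    3 * 4 ^ (k + 1) - 2 ^ (k + 2) ≤
      ∑ j, ∑ v, cycleDist (2 ^ (k + 2)) (f v) (f (flipBit v j)) := by
  have hf' : Function.Bijective fun v => (f v : ZMod (2 ^ (k + 2))) := by
    rw [Fintype.bijective_iff_injective_and_card]
    refine ⟨fun u v h => hf ?_, by simp [ZMod.card]⟩
    have := congrArg ZMod.val h
    simpa only [ZMod.val_natCast_of_lt (hlt _)] using this
  have h1 := le_sum_dirBoundary hf'
  have h2 : ∑ t, dirBoundary (fun v => halfArc (m := k + 1) ((f v : ZMod (2 ^ (k + 2))) - t)) =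
      ∑ j, ∑ v, arcSeparation (m := k + 1) (f v) (f (flipBit v j)) := by
    simp only [dirBoundary, arcSeparation]
    rw [Finset.sum_comm]
    exact Finset.sum_congr rfl fun j _ => Finset.sum_comm
  have h3 : ∑ j, ∑ v, arcSeparation (m := k + 1) (f v) (f (flipBit v j)) ≤
      ∑ j, ∑ v, 2 * cycleDist (2 ^ (k + 2)) (f v) (f (flipBit v j)) :=
    Finset.sum_le_sum fun j _ => Finset.sum_le_sum fun v _ =>
      arcSeparation_le (hlt _).le (hlt _).le
  simp only [← Finset.mul_sum] at h3
  linarith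

end CyclicNumbering

/-! ### The lower bound for numberings of the cube along a path -/

section PathNumbering

theorem abs_sub_eq_sum {N a b : ℕ} (ha : a < N) (hb : b < N) :
    |(a : ℤ) - b| = ∑ t ∈ Finset.range N,
      |(if a < t then (1 : ℤ) else 0) - if b < t then 1 else 0| := by
  wlog hab : a ≤ b generalizing a b
  · rw [abs_sub_comm, this hb ha (by omega)]
    exact Finset.sum_congr rfl fun t _ => abs_sub_comm _ _
  have e : ∀ t ∈ Finset.range N, |(if a < t then (1 : ℤ) else 0) - if b < t then 1 else 0| =
      if t ∈ Finset.Ioc a b then 1 else 0 := by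
    intro t _
    simp only [Finset.mem_Ioc]
    split_ifs <;> first | omega | norm_num
  rw [Finset.sum_congr rfl e, Finset.sum_boole]
  have h : (Finset.range N).filter (fun t => t ∈ Finset.Ioc a b) = Finset.Ioc a b := by
    ext t
    simp only [Finset.mem_filter, Finset.mem_range, Finset.mem_Ioc]
    omega
  rw [h, Nat.card_Ioc, abs_sub_comm, Nat.cast_sub hab]
  exact abs_of_nonneg (by omega)

/-- The wirelength (counted twice) of a numbering of the cube along a path. -/
theorem le_sum_abs_sub {n : ℕ} {f : (Fin n → Bool) → ℕ} (hf : f.Injective)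
    (hlt : ∀ v, f v < 2 ^ n) :
    4 ^ n - 2 ^ n ≤ ∑ j, ∑ v, |(f v : ℤ) - f (flipBit v j)| := by
  have himg : Finset.univ.image f = Finset.range (2 ^ n) := by
    refine Finset.eq_of_subset_of_card_le (fun x hx => ?_) ?_
    · obtain ⟨v, _, rfl⟩ := Finset.mem_image.1 hx
      exact Finset.mem_range.2 (hlt v)
    · rw [Finset.card_image_of_injective _ hf]
      simp
  have hsum : ∀ t ∈ Finset.range (2 ^ n), ∑ v, (if f v < t then (1 : ℤ) else 0) = t := by
    intro t ht
    have := Finset.sum_image (s := Finset.univ) (f := fun x => if x < t then (1 : ℤ) else 0)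
      (hf.injOn (s := ((Finset.univ : Finset (Fin n → Bool)) : Set _)))
    rw [← this, himg, Finset.sum_boole]
    have h : (Finset.range (2 ^ n)).filter (fun x => x < t) = Finset.range t := by
      ext x
      have := Finset.mem_range.1 ht
      simp only [Finset.mem_filter, Finset.mem_range]
      omega
    rw [h, Finset.card_range]
  calc (4 : ℤ) ^ n - 2 ^ n = ∑ t ∈ Finset.range (2 ^ n), 2 * minBoundary n t := by
        rw [← Finset.mul_sum, minBoundary.sum_range_two_pow]
    _ ≤ ∑ t ∈ Finset.range (2 ^ n), dirBoundary fun v => if f v < t then 1 else 0 := by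
        refine Finset.sum_le_sum fun t ht => ?_
        have := two_mul_minBoundary_le (F := fun v => if f v < t then (1 : ℤ) else 0)
          fun v => by split_ifs <;> simp
        rwa [hsum t ht] at this
    _ = ∑ j, ∑ v, |(f v : ℤ) - f (flipBit v j)| := by
        simp only [dirBoundary]
        rw [Finset.sum_comm]
        refine Finset.sum_congr rfl fun j _ => ?_
        rw [Finset.sum_comm]
        exact Finset.sum_congr rfl fun v _ => (abs_sub_eq_sum (hlt _) (hlt _)).symm

end PathNumbering

/-! ### Numbering the vertices of a set -/

section SetNumbering

variable {n : ℕ}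

/-- The sum of `|ρ u - ρ v|` over the directed edges inside the set `A`. -/
def innerLength (A : Finset (Fin n → Bool)) (ρ : (Fin n → Bool) → ℕ) : ℤ :=
  ∑ j, ∑ v, if v ∈ A ∧ flipBit v j ∈ A then |(ρ v : ℤ) - ρ (flipBit v j)| else 0

/-- `ρ` numbers the elements of `A` from `0` to `#A - 1`. -/
structure IsNumbering (A : Finset (Fin n → Bool)) (ρ : (Fin n → Bool) → ℕ) : Prop where
  injOn : ∀ u ∈ A, ∀ v ∈ A, ρ u = ρ v → u = v
  lt : ∀ v ∈ A, ρ v < A.card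

variable {A : Finset (Fin n → Bool)} {ρ : (Fin n → Bool) → ℕ}

theorem IsNumbering.cast_reverse (h : IsNumbering A ρ) {v : Fin n → Bool} (hv : v ∈ A) :
    ((A.card - 1 - ρ v : ℕ) : ℤ) = A.card - 1 - ρ v := by
  have := h.lt v hv
  omega

theorem IsNumbering.reverse (h : IsNumbering A ρ) :
    IsNumbering A fun v => A.card - 1 - ρ v where
  injOn u hu v hv e := h.injOn u hu v hv (by
    have := h.lt u hu
    have := h.lt v hv
    omega)
  lt v hv := by
    have := h.lt v hv
    omega

theorem IsNumbering.innerLength_reverse (h : IsNumbering A ρ) :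
    innerLength A (fun v => A.card - 1 - ρ v) = innerLength A ρ := by
  refine Finset.sum_congr rfl fun j _ => Finset.sum_congr rfl fun v _ => ?_
  split_ifs with hv
  · simp only [h.cast_reverse hv.1, h.cast_reverse hv.2]
    rw [abs_sub_comm]
    congr 1
    ring
  · rfl

/-- The part of `A` in the half `b` of the cube, with respect to the direction `0`. -/
def halfOf (A : Finset (Fin (n + 1) → Bool)) (b : Bool) : Finset (Fin n → Bool) :=
  Finset.univ.filter fun w => insertBit 0 b w ∈ A

theorem mem_halfOf {A : Finset (Fin (n + 1) → Bool)} {b : Bool} {w : Fin n → Bool} :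
    w ∈ halfOf A b ↔ insertBit 0 b w ∈ A := by simp [halfOf]

theorem card_eq_add_card_halfOf (A : Finset (Fin (n + 1) → Bool)) :
    A.card = (halfOf A false).card + (halfOf A true).card := by
  have h := sum_eq_sum_insertBit 0 fun v => if v ∈ A then 1 else 0
  have e : ∀ {m : ℕ} (B : Finset (Fin m → Bool)), ∑ v, (if v ∈ B then 1 else 0) = B.card := by
    intro m B
    simp
  simp only [← mem_halfOf, e] at h
  exact h

theorem insertBit_zero_tail (v : Fin (n + 1) → Bool) :
    insertBit 0 (v 0) (fun i => v i.succ) = v := by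
  ext i
  refine Fin.cases (by simp) (fun i => ?_) i
  have := insertBit_apply_succAbove 0 (v 0) (fun i => v i.succ) i
  rwa [Fin.succAbove_zero] at this

/-- Numberings of the two halves of `A` joined to a numbering of `A`. -/
theorem exists_numbering_of_halfOf {A : Finset (Fin (n + 1) → Bool)} {σ τ : (Fin n → Bool) → ℕ}
    (hσ : IsNumbering (halfOf A false) σ) (hτ : IsNumbering (halfOf A true) τ) :
    ∃ ρ, IsNumbering A ρ ∧ innerLength A ρ =
      2 * ∑ w ∈ halfOf A false ∩ halfOf A true, ((halfOf A false).card + τ w - σ w : ℤ) +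
        (innerLength (halfOf A false) σ + innerLength (halfOf A true) τ) := by
  set a := (halfOf A false).card with ha
  let ρ : (Fin (n + 1) → Bool) → ℕ := fun v =>
    if v 0 then a + τ (fun i => v i.succ) else σ (fun i => v i.succ)
  have htail : ∀ (b : Bool) (w : Fin n → Bool), (fun i : Fin n => insertBit 0 b w i.succ) = w := by
    intro b w
    ext i
    have := insertBit_apply_succAbove 0 b w i
    rwa [Fin.succAbove_zero] at this
  have hρ0 : ∀ w, ρ (insertBit 0 false w) = σ w := fun w => by simp [ρ, htail]
  have hρ1 : ∀ w, ρ (insertBit 0 true w) = a + τ w := fun w => by simp [ρ, htail]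
  have hcases : ∀ v ∈ A, (∃ w ∈ halfOf A false, v = insertBit 0 false w) ∨
      ∃ w ∈ halfOf A true, v = insertBit 0 true w := by
    intro v hv
    rw [← insertBit_zero_tail v] at hv
    cases h : v 0
    · rw [h] at hv
      exact Or.inl ⟨_, mem_halfOf.2 hv, by rw [← h, insertBit_zero_tail]⟩
    · rw [h] at hv
      exact Or.inr ⟨_, mem_halfOf.2 hv, by rw [← h, insertBit_zero_tail]⟩
  refine ⟨ρ, ⟨fun u hu v hv e => ?_, fun v hv => ?_⟩, ?_⟩
  · rcases hcases u hu with ⟨x, hx, rfl⟩ | ⟨x, hx, rfl⟩ <;>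
      rcases hcases v hv with ⟨y, hy, rfl⟩ | ⟨y, hy, rfl⟩
    · rw [hρ0, hρ0] at e
      rw [hσ.injOn x hx y hy e]
    · rw [hρ0, hρ1] at e
      have := hσ.lt x hx
      omega
    · rw [hρ1, hρ0] at e
      have := hσ.lt y hy
      omega
    · rw [hρ1, hρ1] at e
      rw [hτ.injOn x hx y hy (by omega)]
  · rw [card_eq_add_card_halfOf]
    rcases hcases v hv with ⟨x, hx, rfl⟩ | ⟨x, hx, rfl⟩
    · rw [hρ0]
      have := hσ.lt x hx
      omega
    · rw [hρ1]
      have := hτ.lt x hx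
      omega
  · rw [innerLength, sum_flipBit_eq_insertBit 0
      fun u v => if u ∈ A ∧ v ∈ A then |(ρ u : ℤ) - ρ v| else 0]
    simp only [hρ0, hρ1, ← mem_halfOf]
    congr 1
    · have e1 : ∀ w, (if w ∈ halfOf A false ∧ w ∈ halfOf A true then
          |(σ w : ℤ) - ((a + τ w : ℕ) : ℤ)| else 0) =
          if w ∈ halfOf A false ∩ halfOf A true then (a + τ w - σ w : ℤ) else 0 := by
        intro w
        simp only [Finset.mem_inter]
        split_ifs with h
        · have := hσ.lt w h.1
          push_cast
          rw [abs_sub_comm, abs_of_nonneg (by omega)]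
        · rfl
      have e2 : ∀ w, (if w ∈ halfOf A true ∧ w ∈ halfOf A false then
          |((a + τ w : ℕ) : ℤ) - σ w| else 0) =
          if w ∈ halfOf A false ∩ halfOf A true then (a + τ w - σ w : ℤ) else 0 := by
        intro w
        rw [← e1, abs_sub_comm]
        exact if_congr and_comm rfl rfl
      simp only [e1, e2, Finset.sum_ite_mem, Finset.univ_inter]
      ring
    · congr 1
      refine Finset.sum_congr rfl fun j _ => Finset.sum_congr rfl fun w _ => ?_
      push_cast
      rw [add_sub_add_left_eq_sub]

/-- Every set of `N` vertices of the cube has a numbering in which the edges inside the set have,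
when counted once, a total length of at most `N (N - 1) / 2`. -/
theorem exists_numbering {n : ℕ} : ∀ A : Finset (Fin n → Bool),
    ∃ ρ, IsNumbering A ρ ∧ innerLength A ρ ≤ A.card * (A.card - 1) := by
  induction n with
  | zero =>
    intro A
    refine ⟨fun _ => 0, ⟨fun u _ v _ _ => Subsingleton.elim _ _,
      fun v hv => Finset.card_pos.2 ⟨v, hv⟩⟩, ?_⟩
    rcases A.card.eq_zero_or_pos with h | h
    · simp [innerLength, h]
    · have : (1 : ℤ) ≤ A.card := by exact_mod_cast h
      simp only [innerLength, Finset.univ_eq_empty, Finset.sum_empty]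
      exact mul_nonneg (by omega) (by omega)
  | succ n ih =>
    intro A
    obtain ⟨σ, hσ, hσ'⟩ := ih (halfOf A false)
    obtain ⟨τ, hτ, hτ'⟩ := ih (halfOf A true)
    -- use these numberings or the reversed ones: on average an edge between the halves has the
    -- length `#A / 2`
    obtain ⟨ρ₁, h₁, h₁'⟩ := exists_numbering_of_halfOf hσ hτ
    obtain ⟨ρ₂, h₂, h₂'⟩ := exists_numbering_of_halfOf hσ.reverse hτ.reverse
    rw [hσ.innerLength_reverse, hτ.innerLength_reverse] at h₂'
    set a := (halfOf A false).card
    set b := (halfOf A true).card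
    have hcard : (A.card : ℤ) = a + b := by exact_mod_cast card_eq_add_card_halfOf A
    have hsum : ∑ w ∈ halfOf A false ∩ halfOf A true, (a + τ w - σ w : ℤ) +
        ∑ w ∈ halfOf A false ∩ halfOf A true,
          (a + ((b - 1 - τ w : ℕ) : ℤ) - ((a - 1 - σ w : ℕ) : ℤ)) =
        (halfOf A false ∩ halfOf A true).card * (a + b) := by
      rw [← Finset.sum_add_distrib, ← nsmul_eq_mul, ← Finset.sum_const]
      refine Finset.sum_congr rfl fun w hw => ?_
      rw [Finset.mem_inter] at hw
      rw [hσ.cast_reverse hw.1, hτ.cast_reverse hw.2]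
      ring
    have hle : ((halfOf A false ∩ halfOf A true).card : ℤ) * (a + b) ≤ 2 * (a * b) := by
      have ha : ((halfOf A false ∩ halfOf A true).card : ℤ) ≤ a := by
        exact_mod_cast Finset.card_le_card Finset.inter_subset_left
      have hb : ((halfOf A false ∩ halfOf A true).card : ℤ) ≤ b := by
        exact_mod_cast Finset.card_le_card Finset.inter_subset_right
      nlinarith
    rcases le_total (∑ w ∈ halfOf A false ∩ halfOf A true, (a + τ w - σ w : ℤ))
      (∑ w ∈ halfOf A false ∩ halfOf A true,
          (a + ((b - 1 - τ w : ℕ) : ℤ) - ((a - 1 - σ w : ℕ) : ℤ))) with h | h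
    · refine ⟨ρ₁, h₁, ?_⟩
      rw [h₁', hcard]
      linarith
    · refine ⟨ρ₂, h₂, ?_⟩
      rw [h₂', hcard]
      linarith

end SetNumbering

/-! ### The lower bound for one factor -/

section Factor

/-- The distance of the positions `a` and `b` in the path or cycle with `N` vertices. -/
def FactorKind.posDist : FactorKind → ℤ → ℤ → ℤ → ℤ
  | .path, _, a, b => |a - b|
  | .cycle, N, a, b => cycleDist N a b

namespace FactorKind

theorem posDist_comm (c : FactorKind) (N a b : ℤ) : c.posDist N a b = c.posDist N b a := by
  cases c
  · exact abs_sub_comm a b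
  · exact cycleDist_comm N a b

theorem posDist_le_abs (c : FactorKind) (N a b : ℤ) : c.posDist N a b ≤ |a - b| := by
  cases c
  · exact le_rfl
  · exact min_le_left _ _

/-- When every position is replaced by a block of `N` positions, the distances between the blocks
are multiplied by `N` on average over the two orientations of the blocks. -/
theorem posDist_block_le (c : FactorKind) {N M a b x y : ℤ} (hx : 0 ≤ x) (hx' : x < N)
    (hy : 0 ≤ y) (hy' : y < N) (hab : a ≠ b) :
    c.posDist (N * M) (N * a + x) (N * b + y) +
      c.posDist (N * M) (N * a + (N - 1 - x)) (N * b + (N - 1 - y)) ≤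
        2 * (N * c.posDist M a b) := by
  wlog h : a < b generalizing a b x y
  · rw [c.posDist_comm _ (N * a + x), c.posDist_comm _ (N * a + (N - 1 - x)), c.posDist_comm M]
    exact this hy hy' hx hx' hab.symm (by omega)
  have h1 : N ≤ N * (b - a) := by nlinarith
  have e1 : |N * a + x - (N * b + y)| = N * (b - a) + y - x := by
    rw [show N * a + x - (N * b + y) = -(N * (b - a) + y - x) by ring, abs_neg]
    exact abs_of_nonneg (by linarith)
  have e2 : |N * a + (N - 1 - x) - (N * b + (N - 1 - y))| = N * (b - a) + x - y := by
    rw [show N * a + (N - 1 - x) - (N * b + (N - 1 - y)) = -(N * (b - a) + x - y) by ring, abs_neg]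
    exact abs_of_nonneg (by linarith)
  have e3 : |a - b| = b - a := by
    rw [abs_sub_comm]
    exact abs_of_nonneg (by omega)
  cases c
  · simp only [posDist, e1, e2, e3]
    linarith
  · simp only [posDist, cycleDist, e1, e2, e3]
    rcases min_cases (b - a) (M - (b - a)) with ⟨e, _⟩ | ⟨e, _⟩ <;> rw [e]
    · have h1 := min_le_left (N * (b - a) + y - x) (N * M - (N * (b - a) + y - x))
      have h2 := min_le_left (N * (b - a) + x - y) (N * M - (N * (b - a) + x - y))
      linarith
    · have h1 := min_le_right (N * (b - a) + y - x) (N * M - (N * (b - a) + y - x))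
      have h2 := min_le_right (N * (b - a) + x - y) (N * M - (N * (b - a) + x - y))
      linarith

theorem two_mul_contribution_path (n : ℕ) {m : ℕ} (hm : 2 ≤ m) :
    2 * (path.contribution n m : ℤ) = 2 ^ (n - m) * (4 ^ m - 2 ^ m) := by
  obtain ⟨m, rfl⟩ := Nat.exists_eq_add_of_le' hm
  have e : 2 ^ (2 * (m + 2) - 1) = 2 ^ (m + 2 - 1) * 2 ^ (m + 2) := by
    rw [← pow_add]; congr 1; omega
  have h : 2 ^ (m + 2 - 1) ≤ 2 ^ (2 * (m + 2) - 1) := Nat.pow_le_pow_right (by norm_num) (by omega)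
  have e4 : (4 : ℤ) ^ (m + 2) = 2 ^ (m + 2) * 2 ^ (m + 2) := by rw [← mul_pow]; norm_num
  rw [contribution, Nat.cast_mul, Nat.cast_sub h, e, e4, show m + 2 - 1 = m + 1 by omega]
  push_cast
  ring

theorem two_mul_contribution_cycle (n : ℕ) {m : ℕ} (hm : 2 ≤ m) :
    2 * (cycle.contribution n m : ℤ) = 2 ^ (n - m) * (3 * 4 ^ (m - 1) - 2 ^ m) := by
  obtain ⟨m, rfl⟩ := Nat.exists_eq_add_of_le' hm
  have e : 2 ^ (2 * (m + 2) - 3) = 2 * 2 ^ m * 2 ^ m := by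
    rw [show 2 * (m + 2) - 3 = m + m + 1 by omega]; ring
  have h : 2 ^ (m + 2 - 1) ≤ 3 * 2 ^ (2 * (m + 2) - 3) :=
    (Nat.pow_le_pow_right (by norm_num) (by omega)).trans (Nat.le_mul_of_pos_left _ (by norm_num))
  have e4 : (4 : ℤ) ^ m = 2 ^ m * 2 ^ m := by rw [← mul_pow]; norm_num
  rw [contribution, Nat.cast_mul, Nat.cast_sub h, e, show m + 2 - 1 = m + 1 by omega,
    pow_succ 4 m, e4]
  push_cast
  ring

/-- The lower bound for a bijective numbering. -/
theorem le_sum_posDist (c : FactorKind) {n : ℕ} (hn : 2 ≤ n) {f : (Fin n → Bool) → ℕ}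
    (hf : f.Injective) (hlt : ∀ v, f v < 2 ^ n) :
    2 * (c.contribution n n : ℤ) ≤ ∑ j, ∑ v, c.posDist (2 ^ n) (f v) (f (flipBit v j)) := by
  cases c
  · rw [two_mul_contribution_path n hn, Nat.sub_self, pow_zero, one_mul]
    exact le_sum_abs_sub hf hlt
  · rw [two_mul_contribution_cycle n hn, Nat.sub_self, pow_zero, one_mul]
    obtain ⟨k, rfl⟩ := Nat.exists_eq_add_of_le' hn
    exact le_sum_cycleDist hf hlt

/-- The contributions to the wirelength of the blow-up of a map with fibres of size
`N = 2 ^ (n - m)`: the edges between the fibres, and those inside the `2 ^ m` fibres. -/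
theorem two_mul_contribution_self (c : FactorKind) {n m : ℕ} (hm : 2 ≤ m) (hmn : m ≤ n) :
    2 * (c.contribution n n : ℤ) = 2 ^ (n - m) * (2 * c.contribution n m) +
      2 ^ m * (2 ^ (n - m) * (2 ^ (n - m) - 1)) := by
  obtain ⟨d, rfl⟩ := Nat.exists_eq_add_of_le hmn
  obtain ⟨m, rfl⟩ := Nat.exists_eq_add_of_le' hm
  have e4 : ∀ j : ℕ, (4 : ℤ) ^ j = 2 ^ j * 2 ^ j := fun j => by rw [← mul_pow]; norm_num
  cases c
  · rw [two_mul_contribution_path _ (by omega), two_mul_contribution_path _ (by omega),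
      Nat.sub_self, Nat.add_sub_cancel_left, e4, e4]
    ring
  · rw [two_mul_contribution_cycle _ (by omega), two_mul_contribution_cycle _ (by omega),
      Nat.sub_self, Nat.add_sub_cancel_left, e4, e4, show m + 2 + d - 1 = m + 1 + d by omega,
      show m + 2 - 1 = m + 1 by omega]
    ring

/-- The lower bound for a map to the path or cycle with `2 ^ m` vertices whose fibres have the same
size: the fibres are expanded to blocks of positions, in both orientations. -/
theorem le_sum_posDist_of_card_fiber (c : FactorKind) {n m : ℕ} (hm : 2 ≤ m) (hmn : m ≤ n)
    {F : (Fin n → Bool) → ℕ} (hlt : ∀ v, F v < 2 ^ m)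
    (hcard : ∀ a < 2 ^ m, (Finset.univ.filter fun v => F v = a).card = 2 ^ (n - m)) :
    2 * (c.contribution n m : ℤ) ≤ ∑ j, ∑ v, c.posDist (2 ^ m) (F v) (F (flipBit v j)) := by
  let A : ℕ → Finset (Fin n → Bool) := fun a => Finset.univ.filter fun v => F v = a
  have hA : ∀ v a, v ∈ A a ↔ F v = a := fun v a => by simp [A]
  choose ρ hρ hρ' using fun a => exists_numbering (A a)
  set N : ℕ := 2 ^ (n - m) with hN
  have hNpos : 0 < N := by positivity
  have hNm : N * 2 ^ m = 2 ^ n := by rw [hN, ← pow_add, Nat.sub_add_cancel hmn]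
  have hρlt : ∀ v, ρ (F v) v < N := fun v => by
    rw [← hcard (F v) (hlt v)]
    exact (hρ (F v)).lt v ((hA v _).2 rfl)
  -- the two expanded numberings
  have hnum : ∀ r : (Fin n → Bool) → ℕ, (∀ v, r v < N) →
      (∀ u v, F u = F v → r u = r v → u = v) →
      2 * (c.contribution n n : ℤ) ≤
        ∑ j, ∑ v, c.posDist (N * 2 ^ m) (N * F v + r v)
          (N * F (flipBit v j) + r (flipBit v j)) := by
    intro r hr hr'
    have hinj : Function.Injective fun v => N * F v + r v := by
      intro u v h
      have h : N * F u + r u = N * F v + r v := h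
      have h1 : F u = F v := by
        have := congrArg (· / N) h
        simpa [Nat.mul_add_div hNpos, Nat.div_eq_of_lt (hr _)] using this
      exact hr' u v h1 (by rw [h1] at h; omega)
    have := c.le_sum_posDist (hm.trans hmn) hinj fun v => by
      rw [← hNm]
      calc N * F v + r v < N * F v + N := by have := hr v; omega
        _ = N * (F v + 1) := by ring
        _ ≤ N * 2 ^ m := Nat.mul_le_mul_left _ (hlt v)
    have e : ((N : ℤ)) * 2 ^ m = 2 ^ n := by exact_mod_cast hNm
    rw [e]
    push_cast at this
    exact this
  have h1 := hnum (fun v => ρ (F v) v) hρlt fun u v huv h => by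
    refine (hρ (F u)).injOn u ((hA u _).2 rfl) v ((hA v _).2 huv.symm) ?_
    rw [h, huv]
  have h2 := hnum (fun v => N - 1 - ρ (F v) v) (fun v => by omega) fun u v huv h => by
    refine (hρ (F u)).injOn u ((hA u _).2 rfl) v ((hA v _).2 huv.symm) ?_
    have := hρlt u
    have := hρlt v
    rw [huv] at *
    omega
  have hcast : ∀ v, ((N - 1 - ρ (F v) v : ℕ) : ℤ) = N - 1 - ρ (F v) v := fun v => by
    have := hρlt v
    omega
  simp only [hcast] at h2
  have hinner : ∑ j, ∑ v, (if F v = F (flipBit v j) then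
      |(ρ (F v) v : ℤ) - ρ (F (flipBit v j)) (flipBit v j)| else 0) ≤
        2 ^ m * (N * (N - 1)) := by
    calc ∑ j, ∑ v, (if F v = F (flipBit v j) then
          |(ρ (F v) v : ℤ) - ρ (F (flipBit v j)) (flipBit v j)| else 0) =
        ∑ a ∈ Finset.range (2 ^ m), innerLength (A a) (ρ a) := by
          simp only [innerLength]
          symm
          rw [Finset.sum_comm]
          refine Finset.sum_congr rfl fun j _ => ?_
          rw [Finset.sum_comm]
          refine Finset.sum_congr rfl fun v _ => ?_
          rw [Finset.sum_eq_single_of_mem (F v) (Finset.mem_range.2 (hlt v))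
            fun a _ ha => if_neg fun h => ha ((hA v a).1 h.1).symm]
          simp only [hA, true_and]
          by_cases h : F v = F (flipBit v j)
          · rw [if_pos h, if_pos h.symm, h]
          · rw [if_neg h, if_neg (Ne.symm h)]
      _ ≤ ∑ a ∈ Finset.range (2 ^ m), (N * (N - 1) : ℤ) := by
          refine Finset.sum_le_sum fun a ha => ?_
          have e : (A a).card = N := hcard a (Finset.mem_range.1 ha)
          have := hρ' a
          rwa [e] at this
      _ = 2 ^ m * (N * (N - 1)) := by simp
  have hpoint : ∀ u v,
      c.posDist (N * 2 ^ m) (N * F u + ρ (F u) u) (N * F v + ρ (F v) v) +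
        c.posDist (N * 2 ^ m) (N * F u + (N - 1 - ρ (F u) u)) (N * F v + (N - 1 - ρ (F v) v)) ≤
      2 * (N * c.posDist (2 ^ m) (F u) (F v)) +
        2 * (if F u = F v then |(ρ (F u) u : ℤ) - ρ (F v) v| else 0) := by
    intro u v
    have hu := hρlt u
    have hv := hρlt v
    by_cases huv : F u = F v
    · have h1 := c.posDist_le_abs (N * 2 ^ m) (N * F u + ρ (F u) u) (N * F v + ρ (F v) v)
      have h2 := c.posDist_le_abs (N * 2 ^ m) (N * F u + (N - 1 - ρ (F u) u))
        (N * F v + (N - 1 - ρ (F v) v))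
      have h3 : c.posDist (2 ^ m) (F u) (F u) = 0 := by
        have : (0 : ℤ) ≤ 2 ^ m := by positivity
        cases c <;> simp [posDist, cycleDist, this]
      rw [if_pos huv]
      rw [← huv] at h1 h2 ⊢
      rw [h3]
      rw [add_sub_add_left_eq_sub] at h1 h2
      rw [sub_sub_sub_cancel_left, abs_sub_comm] at h2
      linarith
    · rw [if_neg huv]
      have := c.posDist_block_le (N := N) (M := 2 ^ m) (a := F u) (b := F v) (x := ρ (F u) u)
        (y := ρ (F v) v) (by omega) (by omega) (by omega) (by omega) (by exact_mod_cast huv)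
      linarith
  have h3 := Finset.sum_le_sum fun j (_ : j ∈ Finset.univ) =>
    Finset.sum_le_sum fun v (_ : v ∈ Finset.univ) => hpoint v (flipBit v j)
  simp only [Finset.sum_add_distrib, ← Finset.mul_sum] at h3
  have h4 := c.two_mul_contribution_self hm hmn
  have e : ((2 : ℤ) ^ (n - m)) = N := by rw [hN]; push_cast; rfl
  rw [e] at h4
  have hN' : (0 : ℤ) < N := by exact_mod_cast hNpos
  refine le_of_mul_le_mul_left ?_ hN'
  linarith

end FactorKind

end Factor

/-! ### The edges of the hypercube -/

section Edges

variable {n : ℕ}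

theorem flipBit_ne (v : Fin n → Bool) (j : Fin n) : flipBit v j ≠ v := fun h => by
  have := congrFun h j
  simp at this

theorem hypercube_adj_iff {u v : Fin n → Bool} :
    (hypercube n).Adj u v ↔ ∃ j, v = flipBit u j := by
  constructor
  · intro h
    obtain ⟨j, hj⟩ := Finset.card_eq_one.1 (show (Finset.univ.filter fun i => u i ≠ v i).card = 1
      from h)
    have hmem : ∀ i, u i ≠ v i ↔ i = j := fun i => by
      rw [← Finset.mem_singleton, ← hj]; simp
    refine ⟨j, funext fun i => ?_⟩
    by_cases hi : i = j
    · subst hi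
      have := (hmem i).2 rfl
      rw [flipBit_apply_same]
      cases h1 : u i <;> cases h2 : v i <;> simp [h1, h2] at this ⊢
    · rw [flipBit_apply_of_ne u hi]
      by_contra h'
      exact hi ((hmem i).1 (Ne.symm h'))
  · rintro ⟨j, rfl⟩
    refine Finset.card_eq_one.2 ⟨j, ?_⟩
    ext i
    by_cases hi : i = j
    · subst hi; simp
    · simp [flipBit_apply_of_ne u hi, hi]

theorem flipBit_right_injective (v : Fin n → Bool) {i j : Fin n}
    (h : flipBit v i = flipBit v j) : i = j := by
  by_contra hij
  have := congrFun h i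
  rw [flipBit_apply_of_ne v hij, flipBit_apply_same] at this
  simp at this

/-- The edge of the hypercube at the vertex `v` in the direction `j`. -/
def hypercubeEdge (j : Fin n) (v : Fin n → Bool) : (hypercube n).edgeSet :=
  ⟨s(v, flipBit v j), (SimpleGraph.mem_edgeSet _).2 (hypercube_adj_iff.2 ⟨j, rfl⟩)⟩

theorem exists_hypercubeEdge (e : (hypercube n).edgeSet) : ∃ j v, e = hypercubeEdge j v := by
  obtain ⟨e, he⟩ := e
  induction e using Sym2.ind with
  | _ u v =>
    obtain ⟨j, rfl⟩ := hypercube_adj_iff.1 ((SimpleGraph.mem_edgeSet _).1 he)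
    exact ⟨j, u, rfl⟩

theorem two_mul_sum_edgeSet [Fintype (hypercube n).edgeSet] (K : (hypercube n).edgeSet → ℤ) :
    2 * ∑ e, K e = ∑ j, ∑ v, K (hypercubeEdge j v) := by
  classical
  rw [← Fintype.sum_prod_type' fun j v => K (hypercubeEdge j v),
    ← Finset.sum_fiberwise (s := Finset.univ) (g := fun p : Fin n × (Fin n → Bool) =>
      hypercubeEdge p.1 p.2), Finset.mul_sum]
  refine Finset.sum_congr rfl fun e _ => ?_
  have hconst : ∀ p ∈ Finset.univ.filter (fun p : Fin n × (Fin n → Bool) =>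
      hypercubeEdge p.1 p.2 = e), K (hypercubeEdge p.1 p.2) = K e := fun p hp => by
    rw [(Finset.mem_filter.1 hp).2]
  rw [Finset.sum_congr rfl hconst, Finset.sum_const]
  obtain ⟨i, u, rfl⟩ := exists_hypercubeEdge e
  have hfib : Finset.univ.filter (fun p : Fin n × (Fin n → Bool) =>
      hypercubeEdge p.1 p.2 = hypercubeEdge i u) = {(i, u), (i, flipBit u i)} := by
    ext ⟨j, v⟩
    simp only [Finset.mem_filter, Finset.mem_univ, true_and, Finset.mem_insert,
      Finset.mem_singleton, Prod.mk.injEq, hypercubeEdge, Subtype.mk.injEq, Sym2.eq_iff]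
    constructor
    · rintro (⟨rfl, h⟩ | ⟨rfl, h⟩)
      · exact Or.inl ⟨flipBit_right_injective _ h, rfl⟩
      · refine Or.inr ⟨flipBit_right_injective (flipBit u i) ?_, rfl⟩
        rw [h, flipBit_flipBit]
    · rintro (⟨rfl, rfl⟩ | ⟨rfl, rfl⟩)
      · exact Or.inl ⟨rfl, rfl⟩
      · exact Or.inr ⟨rfl, flipBit_flipBit _ _⟩
  rw [hfib, Finset.card_pair fun h => flipBit_ne u i (Prod.mk.inj h).2.symm, nsmul_eq_mul]
  norm_num

end Edges

/-! ### Distances in the host graph -/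

section Host

namespace FactorKind

theorem path_adj {N : ℕ} {a b : Fin N} :
    (path.graph N).Adj a b ↔ a.val + 1 = b.val ∨ b.val + 1 = a.val :=
  SimpleGraph.pathGraph_adj

theorem cycle_adj {N : ℕ} {a b : Fin N} :
    (cycle.graph N).Adj a b ↔ (a - b).val = 1 ∨ (b - a).val = 1 :=
  SimpleGraph.cycleGraph_adj'

theorem posDist_triangle (c : FactorKind) {N x y z : ℤ} :
    c.posDist N x z ≤ |x - y| + c.posDist N y z := by
  have h1 := abs_sub_le x y z
  have h2 := abs_sub_le y x z
  rw [abs_sub_comm y x] at h2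
  cases c
  · exact h1
  · simp only [posDist, cycleDist]
    rcases min_cases |y - z| (N - |y - z|) with ⟨e, _⟩ | ⟨e, _⟩ <;> rw [e]
    · exact (min_le_left _ _).trans h1
    · exact (min_le_right _ _).trans (by linarith)

/-- The distance of the positions is a lower bound for the distance in the graph: it changes by at
most one along an edge. -/
theorem posDist_le_of_adj (c : FactorKind) {N : ℕ} {a b : Fin N} (h : (c.graph N).Adj a b)
    (z : Fin N) : c.posDist N a z ≤ 1 + c.posDist N b z := by
  cases c
  · rw [path_adj] at h
    refine (posDist_triangle path (y := (b : ℤ))).trans (add_le_add_left ?_ _)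
    rw [abs_le]
    omega
  · rw [cycle_adj] at h
    have ha := a.isLt
    have hb := b.isLt
    have hz := z.isLt
    have hcases : a.val + 1 = b.val ∨ b.val + 1 = a.val ∨ a.val + 1 = b.val + N ∨
        b.val + 1 = a.val + N := by
      rcases le_total a b with hab | hab
      · have h1 := Fin.coe_sub_iff_le.2 hab
        rcases hab.lt_or_eq with hab | rfl
        · have h2 := Fin.coe_sub_iff_lt.2 hab
          omega
        · omega
      · have h1 := Fin.coe_sub_iff_le.2 hab
        rcases hab.lt_or_eq with hab | rfl
        · have h2 := Fin.coe_sub_iff_lt.2 hab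
          omega
        · omega
    simp only [posDist, cycleDist]
    rcases abs_cases ((a : ℤ) - z) with ⟨e, _⟩ | ⟨e, _⟩ <;>
      rcases abs_cases ((b : ℤ) - z) with ⟨e', _⟩ | ⟨e', _⟩ <;> rw [e, e'] <;> omega

theorem exists_path_walk {N : ℕ} (a b : Fin N) :
    ∃ p : (path.graph N).Walk a b, (p.length : ℤ) = |(a : ℤ) - b| := by
  wlog hab : a ≤ b generalizing a b
  · obtain ⟨p, hp⟩ := this b a (le_of_not_ge hab)
    exact ⟨p.reverse, by rw [SimpleGraph.Walk.length_reverse, hp, abs_sub_comm]⟩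
  obtain ⟨j, hj⟩ := Nat.exists_eq_add_of_le (show a.val ≤ b.val from hab)
  have e : |(a : ℤ) - b| = j := by rw [abs_sub_comm, abs_of_nonneg] <;> omega
  rw [e]
  clear e hab
  induction j generalizing a with
  | zero =>
    obtain rfl : a = b := Fin.ext (by omega)
    exact ⟨.nil, by simp⟩
  | succ j ih =>
    obtain ⟨p, hp⟩ := ih ⟨a.val + 1, by have := b.isLt; omega⟩ (by simp only; omega)
    refine ⟨.cons (path_adj.2 (Or.inl rfl)) p, ?_⟩
    rw [SimpleGraph.Walk.length_cons]
    push_cast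
    omega

theorem path_le_cycle (N : ℕ) : path.graph N ≤ cycle.graph N :=
  SimpleGraph.pathGraph_le_cycleGraph

theorem exists_walk_length_le (c : FactorKind) {N : ℕ} (hN : 2 ≤ N) (a b : Fin N) :
    ∃ p : (c.graph N).Walk a b, (p.length : ℤ) ≤ c.posDist N a b := by
  cases c
  · obtain ⟨p, hp⟩ := exists_path_walk a b
    exact ⟨p, hp.le⟩
  · wlog hab : a ≤ b generalizing a b
    · obtain ⟨p, hp⟩ := this b a (le_of_not_ge hab)
      exact ⟨p.reverse, by rwa [SimpleGraph.Walk.length_reverse, posDist_comm]⟩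
    simp only [posDist, cycleDist]
    rcases min_cases |(a : ℤ) - b| (N - |(a : ℤ) - b|) with ⟨e, _⟩ | ⟨e, _⟩ <;> rw [e]
    · obtain ⟨p, hp⟩ := exists_path_walk a b
      exact ⟨p.mapLe (path_le_cycle N), by rw [SimpleGraph.Walk.length_mapLe, hp]⟩
    · -- go down to `0`, and then from the last vertex down to `b`
      let z : Fin N := ⟨0, by omega⟩
      let l : Fin N := ⟨N - 1, by omega⟩
      obtain ⟨p, hp⟩ := exists_path_walk a z
      obtain ⟨q, hq⟩ := exists_path_walk l b
      have hzl : (cycle.graph N).Adj z l := by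
        rw [cycle_adj]
        have := Fin.coe_sub_iff_lt.2 (show z < l from Fin.lt_def.2 (by simp only [z, l]; omega))
        left
        simp only [z, l] at this ⊢
        omega
      refine ⟨(p.mapLe (path_le_cycle N)).append (.cons hzl (q.mapLe (path_le_cycle N))), ?_⟩
      rw [SimpleGraph.Walk.length_append, SimpleGraph.Walk.length_cons,
        SimpleGraph.Walk.length_mapLe, SimpleGraph.Walk.length_mapLe]
      push_cast
      have hab' : a.val ≤ b.val := hab
      have hb := b.isLt
      rw [hp, hq, abs_sub_comm (a : ℤ) b, abs_of_nonneg (by simp [z]),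
        abs_of_nonneg (by simp only [l]; omega), abs_of_nonneg (by omega)]
      simp only [z, l]
      omega

end FactorKind

variable {k : ℕ} {d : Fin k → ℕ} {c : Fin k → FactorKind}

/-- The inclusion of the factor `i` into the product, at a given vertex. -/
def factorHom (c : Fin k → FactorKind) (x : (i : Fin k) → Fin (2 ^ d i)) (i : Fin k) :
    (c i).graph (2 ^ d i) →g factorProduct d c where
  toFun a := Function.update x i a
  map_rel' {a b} h := ⟨i, by simpa using h, fun j hj => by simp [hj]⟩

theorem sum_posDist_le_length {x y : (i : Fin k) → Fin (2 ^ d i)}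
    (p : (factorProduct d c).Walk x y) :
    ∑ i, (c i).posDist (2 ^ d i) (x i) (y i) ≤ p.length := by
  induction p with
  | nil =>
    have : ∀ (c : FactorKind) (m : ℕ) (a : ℤ), c.posDist (2 ^ m) a a = 0 := by
      intro c m a
      have : (0 : ℤ) ≤ 2 ^ m := by positivity
      cases c <;> simp [FactorKind.posDist, cycleDist, this]
    simp [this]
  | @cons x z y h p ih =>
    rw [SimpleGraph.Walk.length_cons]
    obtain ⟨i, hi, hne⟩ := h
    have hle : ∀ j, (c j).posDist (2 ^ d j) (x j) (y j) ≤
        (if j = i then 1 else 0) + (c j).posDist (2 ^ d j) (z j) (y j) := by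
      intro j
      by_cases hj : j = i
      · subst hj
        rw [if_pos rfl]
        have := (c j).posDist_le_of_adj hi (y j)
        push_cast at this
        exact this
      · rw [if_neg hj, hne j hj, zero_add]
    refine (Finset.sum_le_sum fun j _ => hle j).trans ?_
    rw [Finset.sum_add_distrib]
    simp only [Finset.sum_ite_eq', Finset.mem_univ, if_true]
    push_cast
    linarith

theorem exists_walk_of_eq_off (hd : ∀ i, 2 ≤ d i) {x y : (i : Fin k) → Fin (2 ^ d i)} {i : Fin k}
    (hxy : ∀ j, j ≠ i → x j = y j) : ∃ p : (factorProduct d c).Walk x y,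
      (p.length : ℤ) ≤ (c i).posDist (2 ^ d i) (x i) (y i) := by
  have h2 : 2 ≤ 2 ^ d i := (hd i).trans Nat.lt_two_pow_self.le
  obtain ⟨p, hp⟩ := (c i).exists_walk_length_le h2 (x i) (y i)
  have hx : factorHom c x i (x i) = x := Function.update_eq_self i x
  have hy : factorHom c x i (y i) = y := by
    ext j
    change ((Function.update x i (y i) j : Fin _) : ℕ) = _
    by_cases hj : j = i
    · subst hj; simp
    · simp [hj, hxy j hj]
  refine ⟨(p.map (factorHom c x i)).copy hx hy, ?_⟩
  rw [SimpleGraph.Walk.length_copy, SimpleGraph.Walk.length_map]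
  push_cast at hp
  exact hp

end Host

/-! ### The Gray code on one block -/

section Gray

theorem grayCode_insertBit_false {m : ℕ} (w : Fin m → Bool) :
    (grayCode (m + 1) (insertBit 0 false w)).val = (grayCode m w).val := by
  have h0 : insertBit 0 false w 0 = false := insertBit_apply_same 0 false w
  have ht : (fun i : Fin m => insertBit 0 false w i.succ) = w := by
    ext i
    have := insertBit_apply_succAbove 0 false w i
    rwa [Fin.succAbove_zero] at this
  simp only [grayCode, h0, ht, Bool.false_eq_true, if_false, Fin.val_castLE]

theorem grayCode_insertBit_true {m : ℕ} (w : Fin m → Bool) :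
    (grayCode (m + 1) (insertBit 0 true w)).val = 2 ^ (m + 1) - 1 - (grayCode m w).val := by
  have h0 : insertBit 0 true w 0 = true := insertBit_apply_same 0 true w
  have ht : (fun i : Fin m => insertBit 0 true w i.succ) = w := by
    ext i
    have := insertBit_apply_succAbove 0 true w i
    rwa [Fin.succAbove_zero] at this
  simp only [grayCode, h0, ht, if_true, Fin.val_rev, Fin.val_castLE]
  omega

theorem grayCode_injective (m : ℕ) : Function.Injective (grayCode m) := by
  induction m with
  | zero => intro u v _; exact Subsingleton.elim u v
  | succ m ih =>
    intro u v h
    have h := congrArg Fin.val h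
    rw [← insertBit_zero_tail u, ← insertBit_zero_tail v] at h ⊢
    set x := fun i : Fin m => u i.succ
    set y := fun i : Fin m => v i.succ
    have hx := (grayCode m x).isLt
    have hy := (grayCode m y).isLt
    have hp : 2 ^ (m + 1) = 2 ^ m + 2 ^ m := by ring
    cases hu : u 0 <;> cases hv : v 0 <;> rw [hu, hv] at h <;>
      simp only [grayCode_insertBit_false, grayCode_insertBit_true] at h
    · rw [ih (Fin.ext h)]
    · omega
    · omega
    · rw [ih (Fin.ext (by omega : (grayCode m x).val = (grayCode m y).val))]

theorem grayCode_bijective (m : ℕ) : Function.Bijective (grayCode m) :=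
  (Fintype.bijective_iff_injective_and_card _).2 ⟨grayCode_injective m, by simp⟩

theorem sum_comp_grayCode (m : ℕ) (φ : ℕ → ℤ) :
    ∑ w, φ (grayCode m w).val = ∑ p ∈ Finset.range (2 ^ m), φ p := by
  rw [← Fin.sum_univ_eq_sum_range]
  exact (grayCode_bijective m).sum_comp fun p => φ p.val

/-- The wirelength (counted twice) of the Gray code into the path or cycle of the given kind. -/
def grayLength (c : FactorKind) (m : ℕ) : ℤ :=
  ∑ j, ∑ w, c.posDist (2 ^ m) (grayCode m w).val (grayCode m (flipBit w j)).val

theorem cast_grayCode_insertBit_true {m : ℕ} (w : Fin m → Bool) :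
    ((grayCode (m + 1) (insertBit 0 true w)).val : ℤ) =
      2 * 2 ^ m - 1 - (grayCode m w).val := by
  have h := (grayCode m w).isLt
  have hp : 2 ^ (m + 1) = 2 ^ m + 2 ^ m := by ring
  rw [grayCode_insertBit_true, hp]
  zify at h
  push_cast [show (grayCode m w).val ≤ 2 ^ m + 2 ^ m - 1 by omega,
    show 1 ≤ 2 ^ m + 2 ^ m by have := Nat.one_le_two_pow (n := m); omega]
  ring

/-- The edges in the leading direction join each position to its reflection, and the two halves
are copies of the Gray code of one dimension less. -/
theorem grayLength_succ_le (c : FactorKind) (m : ℕ) : grayLength c (m + 1) ≤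
    2 * ∑ p ∈ Finset.range (2 ^ m), c.posDist (2 * 2 ^ m) p (2 * 2 ^ m - 1 - p) +
      2 * grayLength .path m := by
  rw [grayLength, sum_flipBit_eq_insertBit 0 fun u v =>
    c.posDist (2 ^ (m + 1)) (grayCode (m + 1) u).val (grayCode (m + 1) v).val]
  have e1 : ∀ w, c.posDist (2 ^ (m + 1)) (grayCode (m + 1) (insertBit 0 false w)).val
      (grayCode (m + 1) (insertBit 0 true w)).val =
        c.posDist (2 * 2 ^ m) (grayCode m w).val (2 * 2 ^ m - 1 - (grayCode m w).val) := fun w => by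
    rw [grayCode_insertBit_false, cast_grayCode_insertBit_true, pow_succ']
  have e2 : ∀ w, c.posDist (2 ^ (m + 1)) (grayCode (m + 1) (insertBit 0 true w)).val
      (grayCode (m + 1) (insertBit 0 false w)).val =
        c.posDist (2 * 2 ^ m) (grayCode m w).val (2 * 2 ^ m - 1 - (grayCode m w).val) := fun w => by
    rw [c.posDist_comm, e1]
  have e3 : ∀ b u v, c.posDist (2 ^ (m + 1)) (grayCode (m + 1) (insertBit 0 b u)).val
      (grayCode (m + 1) (insertBit 0 b v)).val ≤
        FactorKind.path.posDist (2 ^ m) (grayCode m u).val (grayCode m v).val := by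
    intro b u v
    refine (c.posDist_le_abs _ _ _).trans (le_of_eq ?_)
    cases b
    · rw [grayCode_insertBit_false, grayCode_insertBit_false]
      rfl
    · rw [cast_grayCode_insertBit_true, cast_grayCode_insertBit_true, sub_sub_sub_cancel_left,
        abs_sub_comm]
      rfl
  have h3 : ∀ b, ∑ j, ∑ w, c.posDist (2 ^ (m + 1)) (grayCode (m + 1) (insertBit 0 b w)).val
      (grayCode (m + 1) (insertBit 0 b (flipBit w j))).val ≤ grayLength .path m := fun b =>
    Finset.sum_le_sum fun j _ => Finset.sum_le_sum fun w _ => e3 b _ _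
  simp only [e1, e2]
  rw [sum_comp_grayCode m fun p => c.posDist (2 * 2 ^ m) p (2 * 2 ^ m - 1 - p)]
  have := h3 false
  have := h3 true
  linarith

theorem grayLength_path_le (m : ℕ) : grayLength .path m ≤ 4 ^ m - 2 ^ m := by
  induction m with
  | zero => simp [grayLength]
  | succ m ih =>
    have h1 := grayLength_succ_le .path m
    have h2 : 2 * ∑ p ∈ Finset.range (2 ^ m), (p : ℤ) = 2 ^ m * (2 ^ m - 1) := by
      have := Finset.sum_range_id_mul_two (2 ^ m)
      have h1 : 1 ≤ 2 ^ m := Nat.one_le_two_pow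
      zify [h1] at this
      linarith
    have h3 : ∑ p ∈ Finset.range (2 ^ m),
        FactorKind.path.posDist (2 * 2 ^ m) p (2 * 2 ^ m - 1 - p) =
          ∑ p ∈ Finset.range (2 ^ m), (2 * 2 ^ m - 1 - 2 * (p : ℤ)) := by
      refine Finset.sum_congr rfl fun p hp => ?_
      have hp : (p : ℤ) < 2 ^ m := by exact_mod_cast Finset.mem_range.1 hp
      rw [FactorKind.posDist, abs_sub_comm, abs_of_nonneg (by omega)]
      ring
    rw [h3, Finset.sum_sub_distrib, ← Finset.mul_sum, h2] at h1
    simp only [Finset.sum_const, Finset.card_range, nsmul_eq_mul] at h1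
    push_cast at h1
    have h4 : (4 : ℤ) ^ m = 2 ^ m * 2 ^ m := by rw [← mul_pow]; norm_num
    rw [pow_succ, pow_succ, h4]
    rw [h4] at ih
    linarith

theorem grayLength_cycle_le (m : ℕ) :
    grayLength .cycle (m + 2) ≤ 3 * 4 ^ (m + 1) - 2 ^ (m + 2) := by
  have h1 := grayLength_succ_le .cycle (m + 1)
  have h2 := grayLength_path_le (m + 1)
  -- the edge between the halves at the position `p` goes through one of the two middles
  have h3 : ∑ p ∈ Finset.range (2 ^ (m + 1)),
      FactorKind.cycle.posDist (2 * 2 ^ (m + 1)) p (2 * 2 ^ (m + 1) - 1 - p) ≤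
        2 ^ m * 2 ^ (m + 1) := by
    rw [show 2 ^ (m + 1) = 2 ^ m + 2 ^ m by ring, Finset.sum_range_add, ← Finset.sum_add_distrib]
    have hp : (2 : ℤ) ^ (m + 1) = 2 ^ m + 2 ^ m := by ring
    have : ∀ p ∈ Finset.range (2 ^ m),
        FactorKind.cycle.posDist (2 * 2 ^ (m + 1)) p (2 * 2 ^ (m + 1) - 1 - p) +
          FactorKind.cycle.posDist (2 * 2 ^ (m + 1)) (2 ^ m + p : ℕ)
            (2 * 2 ^ (m + 1) - 1 - (2 ^ m + p : ℕ)) ≤ 2 ^ (m + 1) := by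
      intro p hpm
      have hpm : (p : ℤ) < 2 ^ m := by exact_mod_cast Finset.mem_range.1 hpm
      have e1 : |(p : ℤ) - (2 * 2 ^ (m + 1) - 1 - p)| = 2 * 2 ^ (m + 1) - 1 - 2 * p := by
        rw [abs_sub_comm, abs_of_nonneg (by omega)]; ring
      have e2 : |((2 ^ m + p : ℕ) : ℤ) - (2 * 2 ^ (m + 1) - 1 - (2 ^ m + p : ℕ))| =
          2 ^ (m + 1) - 1 - 2 * p := by
        push_cast
        rw [abs_sub_comm, abs_of_nonneg (by omega)]; omega
      simp only [FactorKind.posDist, cycleDist, e1, e2]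
      have h5 := min_le_right (2 * 2 ^ (m + 1) - 1 - 2 * (p : ℤ))
        (2 * 2 ^ (m + 1) - (2 * 2 ^ (m + 1) - 1 - 2 * p))
      have h6 := min_le_left (2 ^ (m + 1) - 1 - 2 * (p : ℤ))
        (2 * 2 ^ (m + 1) - (2 ^ (m + 1) - 1 - 2 * p))
      linarith
    refine (Finset.sum_le_sum this).trans (le_of_eq ?_)
    simp
  have h4 : (4 : ℤ) ^ (m + 1) = 2 ^ (m + 1) * 2 ^ (m + 1) := by rw [← mul_pow]; norm_num
  have e : (2 : ℤ) ^ (m + 1) = 2 * 2 ^ m := by ring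
  have e' : (2 : ℤ) ^ (m + 2) = 2 * 2 ^ (m + 1) := by ring
  rw [h4] at h2
  rw [h4, e']
  have : (2 : ℤ) ^ (m + 1) * 2 ^ (m + 1) = 2 * (2 ^ m * 2 ^ (m + 1)) := by rw [e]; ring
  linarith

/-- The Gray code attains the lower bound for one block. -/
theorem pow_mul_grayLength_le (c : FactorKind) (n : ℕ) {m : ℕ} (hm : 2 ≤ m) :
    2 ^ (n - m) * grayLength c m ≤ 2 * c.contribution n m := by
  obtain ⟨m, rfl⟩ := Nat.exists_eq_add_of_le' hm
  cases c
  · rw [FactorKind.two_mul_contribution_path n hm]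
    gcongr
    exact grayLength_path_le _
  · rw [FactorKind.two_mul_contribution_cycle n hm]
    gcongr
    exact grayLength_cycle_le m

end Gray

/-! ### Cutting vectors into blocks -/

section Blocks

variable {k n : ℕ} {d : Fin k → ℕ}

/-- All the fibres of a coordinate of a bijection to a product have the same size. -/
theorem card_fiber {κ : Fin k → Type*} [∀ i, Fintype (κ i)] [∀ i, DecidableEq (κ i)]
    (hn : ∑ i, d i = n) (hκ : ∀ i, Fintype.card (κ i) = 2 ^ d i)
    {B : (Fin n → Bool) → (i : Fin k) → κ i} (hB : B.Bijective) (i : Fin k) (a : κ i) :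
    (Finset.univ.filter fun v => B v i = a).card = 2 ^ (n - d i) := by
  have h1 : (Finset.univ.filter fun v => B v i = a).card =
      (Finset.univ.filter fun x : (i : Fin k) → κ i => x i = a).card := by
    rw [Finset.card_filter, Finset.card_filter]
    exact hB.sum_comp fun x => if x i = a then 1 else 0
  have h2 := Fintype.card_filter_piFinset_eq_of_mem (fun i => (Finset.univ : Finset (κ i))) i
    (Finset.mem_univ a)
  rw [Fintype.piFinset_univ] at h2
  rw [h1, h2]
  simp only [Finset.card_univ, hκ]
  rw [Finset.prod_pow_eq_pow_sum]
  congr 1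
  have := Finset.add_sum_erase Finset.univ d (Finset.mem_univ i)
  omega

theorem sum_comp_coord {κ : Fin k → Type*} [∀ i, Fintype (κ i)] [∀ i, DecidableEq (κ i)]
    (hn : ∑ i, d i = n) (hκ : ∀ i, Fintype.card (κ i) = 2 ^ d i)
    {B : (Fin n → Bool) → (i : Fin k) → κ i} (hB : B.Bijective) (i : Fin k) (g : κ i → ℤ) :
    ∑ v, g (B v i) = 2 ^ (n - d i) * ∑ a, g a := by
  rw [← Finset.sum_fiberwise' (s := Finset.univ) (g := fun v => B v i) (f := g), Finset.mul_sum]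
  refine Finset.sum_congr rfl fun a _ => ?_
  rw [Finset.sum_const, card_fiber hn hκ hB, nsmul_eq_mul]
  push_cast
  rfl

/-- The place in a vector of length `n` of the `l`-th bit of the `i`-th block. -/
def blockIndex (hn : ∑ i, d i = n) : (i : Fin k) × Fin (d i) ≃ Fin n :=
  finSigmaFinEquiv.trans (finCongr hn)

/-- The `i`-th block of a vector. -/
def block (hn : ∑ i, d i = n) (v : Fin n → Bool) (i : Fin k) : Fin (d i) → Bool :=
  fun l => v (blockIndex hn ⟨i, l⟩)

theorem grayCodeTuple_apply (hn : ∑ i, d i = n) (v : Fin n → Bool) (i : Fin k) :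
    grayCodeTuple d hn v i = grayCode (d i) (block hn v i) := rfl

theorem block_injective (hn : ∑ i, d i = n) : Function.Injective (block (k := k) hn) := by
  intro u v h
  ext j
  obtain ⟨⟨i, l⟩, rfl⟩ := (blockIndex hn).surjective j
  exact congrFun (congrFun h i) l

theorem block_bijective (hn : ∑ i, d i = n) : Function.Bijective (block (k := k) hn) := by
  refine (Fintype.bijective_iff_injective_and_card _).2 ⟨block_injective hn, ?_⟩
  simp [Finset.prod_pow_eq_pow_sum, hn]

theorem block_flipBit_same (hn : ∑ i, d i = n) (v : Fin n → Bool) (i : Fin k) (l : Fin (d i)) :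
    block hn (flipBit v (blockIndex hn ⟨i, l⟩)) i = flipBit (block hn v i) l := by
  ext l'
  by_cases h : l' = l
  · subst h
    simp [block]
  · rw [flipBit_apply_of_ne _ h, block, flipBit_apply_of_ne]
    · rfl
    · intro h'
      have := (blockIndex hn).injective h'
      simp only [Sigma.mk.injEq, heq_eq_eq, true_and] at this
      exact h this

theorem block_flipBit_of_ne (hn : ∑ i, d i = n) (v : Fin n → Bool) {i i' : Fin k} (l : Fin (d i))
    (h : i' ≠ i) : block hn (flipBit v (blockIndex hn ⟨i, l⟩)) i' = block hn v i' := by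
  ext l'
  rw [block, flipBit_apply_of_ne]
  · rfl
  · intro h'
    have := (blockIndex hn).injective h'
    simp only [Sigma.mk.injEq] at this
    exact h this.1

theorem grayCodeTuple_injective (hn : ∑ i, d i = n) : Function.Injective (grayCodeTuple d hn) := by
  intro u v h
  refine block_injective hn (funext fun i => grayCode_injective (d i) ?_)
  exact congrFun h i

theorem grayCodeTuple_flipBit_of_ne (hn : ∑ i, d i = n) (v : Fin n → Bool) {i i' : Fin k}
    (l : Fin (d i)) (h : i' ≠ i) :
    grayCodeTuple d hn v i' = grayCodeTuple d hn (flipBit v (blockIndex hn ⟨i, l⟩)) i' := by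
  rw [grayCodeTuple_apply, grayCodeTuple_apply, block_flipBit_of_ne hn v l h]

end Blocks

/-! ### The minimum wirelength -/

section Wirelength

variable {k n : ℕ} {d : Fin k → ℕ} {c : Fin k → FactorKind}

theorem route_ends_hypercubeEdge {W : Type*} {H : SimpleGraph W}
    (φ : GraphEmbedding (hypercube n) H) (j : Fin n) (v : Fin n → Bool) :
    (φ.src (hypercubeEdge j v) = φ.toFun v ∧
        φ.tgt (hypercubeEdge j v) = φ.toFun (flipBit v j)) ∨
      (φ.src (hypercubeEdge j v) = φ.toFun (flipBit v j) ∧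
        φ.tgt (hypercubeEdge j v) = φ.toFun v) := by
  have h : s(φ.src (hypercubeEdge j v), φ.tgt (hypercubeEdge j v)) =
      s(φ.toFun v, φ.toFun (flipBit v j)) := φ.route_ends (hypercubeEdge j v)
  exact Sym2.eq_iff.1 h

theorem two_mul_wirelength {W : Type*} {H : SimpleGraph W} [Fintype (hypercube n).edgeSet]
    (φ : GraphEmbedding (hypercube n) H) : 2 * (φ.wirelength : ℤ) =
      ∑ j, ∑ v, ((φ.route (hypercubeEdge j v)).1.length : ℤ) := by
  rw [← two_mul_sum_edgeSet fun e => ((φ.route e).1.length : ℤ), GraphEmbedding.wirelength]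
  push_cast
  rfl

/-- The lower bound for all embeddings: the length of a path is at least the sum of the distances
of the coordinates of its ends, and each coordinate of a bijection has fibres of the same size. -/
theorem sum_contribution_le_wirelength [Fintype (hypercube n).edgeSet] (hd : ∀ i, 2 ≤ d i)
    (hn : ∑ i, d i = n) (φ : GraphEmbedding (hypercube n) (factorProduct d c)) :
    ∑ i, (c i).contribution n (d i) ≤ φ.wirelength := by
  have hbij : φ.toFun.Bijective :=
    (Fintype.bijective_iff_injective_and_card _).2 ⟨φ.injective, by
      simp [Finset.prod_pow_eq_pow_sum, hn]⟩
  have h1 : ∀ j v, ∑ i, (c i).posDist (2 ^ d i) (φ.toFun v i) (φ.toFun (flipBit v j) i) ≤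
      ((φ.route (hypercubeEdge j v)).1.length : ℤ) := by
    intro j v
    have h := sum_posDist_le_length (φ.route (hypercubeEdge j v)).1
    refine (le_of_eq ?_).trans h
    rcases route_ends_hypercubeEdge φ j v with ⟨e, e'⟩ | ⟨e, e'⟩ <;> rw [e, e']
    exact Finset.sum_congr rfl fun i _ => FactorKind.posDist_comm _ _ _ _
  have h2 : ∀ i, 2 * ((c i).contribution n (d i) : ℤ) ≤
      ∑ j, ∑ v, (c i).posDist (2 ^ d i) (φ.toFun v i) (φ.toFun (flipBit v j) i) := by
    intro i
    have hle : d i ≤ n := hn ▸ Finset.single_le_sum (fun _ _ => Nat.zero_le _) (Finset.mem_univ i)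
    refine (c i).le_sum_posDist_of_card_fiber (hd i) hle (F := fun v => (φ.toFun v i).val)
      (fun v => (φ.toFun v i).isLt) fun a ha => ?_
    rw [← card_fiber hn (fun i => Fintype.card_fin _) hbij i ⟨a, ha⟩]
    simp only [Fin.ext_iff]
  have h3 : 2 * ((∑ i, (c i).contribution n (d i) : ℕ) : ℤ) ≤ 2 * φ.wirelength := by
    rw [two_mul_wirelength]
    push_cast
    rw [Finset.mul_sum]
    refine (Finset.sum_le_sum fun i _ => h2 i).trans ?_
    rw [Finset.sum_comm]
    refine Finset.sum_le_sum fun j _ => ?_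
    rw [Finset.sum_comm]
    exact Finset.sum_le_sum fun v _ => h1 j v
  omega

theorem wirelength_le_of_grayCodeTuple [Fintype (hypercube n).edgeSet] (hd : ∀ i, 2 ≤ d i)
    (hn : ∑ i, d i = n) (φ : GraphEmbedding (hypercube n) (factorProduct d c))
    (hφ : φ.toFun = grayCodeTuple d hn) (hs : φ.UsesShortestPaths) :
    φ.wirelength ≤ ∑ i, (c i).contribution n (d i) := by
  have h1 : ∀ i l v, ((φ.route (hypercubeEdge (blockIndex hn ⟨i, l⟩) v)).1.length : ℤ) ≤
      (c i).posDist (2 ^ d i) (grayCode (d i) (block hn v i)).val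
        (grayCode (d i) (flipBit (block hn v i) l)).val := by
    intro i l v
    rw [hs]
    obtain ⟨p, hp⟩ := exists_walk_of_eq_off (c := c) hd (i := i) fun i' hi' =>
      grayCodeTuple_flipBit_of_ne hn v l hi'
    rw [grayCodeTuple_apply, grayCodeTuple_apply, block_flipBit_same] at hp
    refine le_trans ?_ hp
    have hdist := SimpleGraph.dist_le p
    rcases route_ends_hypercubeEdge φ (blockIndex hn ⟨i, l⟩) v with ⟨e, e'⟩ | ⟨e, e'⟩ <;>
      rw [e, e', hφ]
    · exact_mod_cast hdist
    · rw [SimpleGraph.dist_comm]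
      exact_mod_cast hdist
  have h2 : 2 * (φ.wirelength : ℤ) ≤ 2 * ((∑ i, (c i).contribution n (d i) : ℕ) : ℤ) := by
    rw [two_mul_wirelength, ← Equiv.sum_comp (blockIndex hn), Fintype.sum_sigma]
    push_cast
    rw [Finset.mul_sum]
    refine Finset.sum_le_sum fun i _ => ?_
    refine le_trans ?_ (pow_mul_grayLength_le (c i) n (hd i))
    rw [grayLength, Finset.mul_sum]
    refine Finset.sum_le_sum fun l _ => ?_
    rw [← sum_comp_coord hn (κ := fun i => Fin (d i) → Bool) (fun i => by simp)
      (block_bijective hn) i fun w => (c i).posDist (2 ^ d i) (grayCode (d i) w).val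
        (grayCode (d i) (flipBit w l)).val]
    exact Finset.sum_le_sum fun v _ => h1 i l v
  omega

theorem exists_grayCodeTuple_embedding (hd : ∀ i, 2 ≤ d i) (hn : ∑ i, d i = n)
    (c : Fin k → FactorKind) : ∃ φ : GraphEmbedding (hypercube n) (factorProduct d c),
      φ.toFun = grayCodeTuple d hn ∧ φ.UsesShortestPaths := by
  have h : ∀ e : (hypercube n).edgeSet, ∃ (x y : (i : Fin k) → Fin (2 ^ d i))
      (p : (factorProduct d c).Path x y),
      s(x, y) = Sym2.map (grayCodeTuple d hn) (e : Sym2 (Fin n → Bool)) ∧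
        p.1.length = (factorProduct d c).dist x y := by
    intro e
    obtain ⟨j, v, rfl⟩ := exists_hypercubeEdge e
    obtain ⟨⟨i, l⟩, rfl⟩ := (blockIndex hn).surjective j
    obtain ⟨p, -⟩ := exists_walk_of_eq_off (c := c) hd (i := i) fun i' hi' =>
      grayCodeTuple_flipBit_of_ne hn v l hi'
    obtain ⟨q, hq, hq'⟩ := SimpleGraph.Reachable.exists_path_of_dist ⟨p⟩
    exact ⟨_, _, ⟨q, hq⟩, rfl, hq'⟩
  choose x y p hp hp' using h
  exact ⟨⟨grayCodeTuple d hn, grayCodeTuple_injective hn, x, y, p, hp⟩, rfl, hp'⟩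

end Wirelength

theorem theorem2 (k n : ℕ) (hk : 0 < k) (d : Fin k → ℕ) (hd : ∀ i, 2 ≤ d i)
    (hn : ∑ i, d i = n) (c : Fin k → FactorKind) :
    -- the minimum wirelength of `Q_n` into the product, over all embeddings
    IsLeast (Set.range fun φ : GraphEmbedding (hypercube n) (factorProduct d c) => φ.wirelength)
      (∑ i, (c i).contribution n (d i)) ∧
    -- the Gray code map with shortest paths is an embedding, and it attains this minimum
    (∃ φ : GraphEmbedding (hypercube n) (factorProduct d c),
      φ.toFun = grayCodeTuple d hn ∧ φ.UsesShortestPaths) ∧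
    (∀ φ : GraphEmbedding (hypercube n) (factorProduct d c),
      φ.toFun = grayCodeTuple d hn → φ.UsesShortestPaths →
        φ.wirelength = ∑ i, (c i).contribution n (d i)) := by

  have heq : ∀ φ : GraphEmbedding (hypercube n) (factorProduct d c),
      φ.toFun = grayCodeTuple d hn → φ.UsesShortestPaths →
        φ.wirelength = ∑ i, (c i).contribution n (d i) := fun φ hφ hs =>
    le_antisymm (wirelength_le_of_grayCodeTuple hd hn φ hφ hs)
      (sum_contribution_le_wirelength hd hn φ)
  obtain ⟨φ, hφ, hs⟩ := exists_grayCodeTuple_embedding hd hn c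
  refine ⟨⟨⟨φ, heq φ hφ hs⟩, ?_⟩, ⟨φ, hφ, hs⟩, heq⟩
  rintro _ ⟨ψ, rfl⟩
  exact sum_contribution_le_wirelength hd hn ψ
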